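/- Let $L=K_1\cup\cdots\cup K_n$ be a (tame) link diagram on the plane: finitely many closed curves in $\mathbb{R}^2$ whose only singularities are finitely many transverse double points (the crossing points), with over/under information at each of them. Tame means that some homeomorphism of the plane carries the curves to closed polygons in general position. The projection of $L$ is the subset $K_1\cup\cdots\cup K_n$ of $\mathbb{R}^2$, and a region of $L$ is a connected component of its complement. A region crossing change on a region $R$ switches, once each, all the crossing points that lie on the boundary of $R$. A crossing point $c$ is called region crossing change admissible if some finite sequence of region crossing changes transforms $L$ into the diagram obtained from $L$ by switching $c$ alone. Then every crossing point of $L$ is region crossing change admissible if and only if each component $K_i$ is isolated, i.e. disjoint from all $K_j$ with $j\neq i$. Moreover, each $K_i$ is isolated if and only if the projection of $L$ has exactly $n$ connected components. -/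

import Mathlib

/-- The plane `ℝ²`, realised as `ℂ` (only its topology and its real vector space
structure are used). -/
abbrev Plane : Type := ℂ

/-- The projection (on the plane) of a tame link diagram with `n` components:
the image, under a homeomorphism `ambient` of the plane, of `n` closed polygons
in general position.  Component `i` is the closed polygon with the cyclically
ordered vertices `vertex i k`, `k : ZMod (size i)`.  For polygonal diagrams `ambient` is the
identity. -/
structure LinkProjection (n : ℕ) where
  /-- the number of vertices of each component -/
  size : Fin n → ℕ
  three_le_size : ∀ i, 3 ≤ size i
  /-- the vertices of each component, in cyclic order -/
  vertex : (i : Fin n) → ZMod (size i) → Plane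
  /-- A vertex lies on no edge but the two edges that it bounds.  (So two edges that meet away
  from the vertices meet transversally, in one interior point of each.) -/
  vertex_generic : ∀ (i : Fin n) (k : ZMod (size i)) (j : Fin n) (l : ZMod (size j)),
    vertex i k ∈ segment ℝ (vertex j l) (vertex j (l + 1)) →
      (⟨i, k⟩ : Σ i, ZMod (size i)) = ⟨j, l⟩ ∨ (⟨i, k⟩ : Σ i, ZMod (size i)) = ⟨j, l + 1⟩
  /-- No point lies on three different edges. -/
  no_triple : ∀ e f g : Σ i, ZMod (size i), e ≠ f → e ≠ g → f ≠ g →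
    segment ℝ (vertex e.1 e.2) (vertex e.1 (e.2 + 1)) ∩
      segment ℝ (vertex f.1 f.2) (vertex f.1 (f.2 + 1)) ∩
      segment ℝ (vertex g.1 g.2) (vertex g.1 (g.2 + 1)) = ∅
  /-- the homeomorphism of the plane that carries the polygons to the components -/
  ambient : Plane ≃ₜ Plane

namespace LinkProjection

variable {n : ℕ}

/-- The edges of the polygons: edge `⟨i, k⟩` joins vertex `k` of component `i` to vertex
`k + 1`. -/
abbrev Edge (P : LinkProjection n) : Type := Σ i : Fin n, ZMod (P.size i)

/-- The arc in the plane that corresponds to an edge. -/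
def arc (P : LinkProjection n) (e : P.Edge) : Set Plane :=
  P.ambient '' segment ℝ (P.vertex e.1 e.2) (P.vertex e.1 (e.2 + 1))

/-- The `i`-th component `K_i`, as a subset of the plane. -/
def component (P : LinkProjection n) (i : Fin n) : Set Plane :=
  ⋃ k : ZMod (P.size i), P.arc ⟨i, k⟩

/-- The projection `K_1 ∪ ⋯ ∪ K_n`, as a subset of the plane. -/
def carrier (P : LinkProjection n) : Set Plane := ⋃ i, P.component i

/-- The crossing points: points other than (the images of) the vertices that lie on two different
arcs. -/
def crossings (P : LinkProjection n) : Set Plane :=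
  {x | (∀ i k, x ≠ P.ambient (P.vertex i k)) ∧
    ∃ e f : P.Edge, e ≠ f ∧ x ∈ P.arc e ∧ x ∈ P.arc f}

/-- The regions: the connected components of the complement of the projection. -/
def IsRegion (P : LinkProjection n) (R : Set Plane) : Prop :=
  ∃ x ∈ P.carrierᶜ, R = connectedComponentIn P.carrierᶜ x

/-- The crossing points incident to `R`. -/
def incident (P : LinkProjection n) (R : Set Plane) : Set P.crossings :=
  {c | (c : Plane) ∈ closure R}

/-- `K_i` is isolated: it is disjoint from all the other components. -/
def IsIsolated (P : LinkProjection n) (i : Fin n) : Prop :=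
  ∀ j, j ≠ i → Disjoint (P.component i) (P.component j)

/-- A link diagram with projection `P`: for each crossing point, the choice of the overcrossing
arc among the two arcs through that point. -/
@[ext]
structure Diagram (P : LinkProjection n) where
  /-- the overcrossing arc -/
  overArc : P.crossings → P.Edge
  overArc_mem : ∀ c : P.crossings, (c : Plane) ∈ P.arc (overArc c)

namespace Diagram

variable {P : LinkProjection n}

/-- `D'` is obtained from `D` by switching exactly the crossing points in `S`.  (Exactly two arcs
pass through a crossing point.) -/
def IsSwitch (S : Set P.crossings) (D D' : P.Diagram) : Prop :=
  ∀ c, D'.overArc c ≠ D.overArc c ↔ c ∈ S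

/-- `D'` is obtained from `D` by one (original) region crossing change: for some region `R`, all
the crossing points incident to `R` are switched, each of them once. -/
def RegionCrossingChange (D D' : P.Diagram) : Prop :=
  ∃ R, P.IsRegion R ∧ IsSwitch (P.incident R) D D'

/-- A set `S` of crossing points of `D` is region crossing change admissible: the diagram obtained
from `D` by switching the crossing points in `S` can be obtained from `D` by a finite sequence of
region crossing changes. -/
def Admissible (D : P.Diagram) (S : Set P.crossings) : Prop :=
  ∃ D', IsSwitch S D D' ∧ Relation.ReflTransGen RegionCrossingChange D D'

end Diagram

end LinkProjection

/-! Over `ZMod 2`, a region crossing change adds the incidence vector of a region to the record of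
switched crossing points. Hence all crossing points are admissible exactly when these vectors span,
that is, when no nonzero weight `w` on the crossing points has sum zero over the boundary of every
region.

Suppose that `K_i` meets another component. The crossing points of `K_i` with the other components
then form such a weight (`sum_strandParity_mul_incident`). Walk once round `K_i` and record the sum,
over the two sides, of the indicator of a region. The record changes at a crossing point by the sum
over its four corners, and it returns to its initial value. Self-crossings are passed twice and
cancel. At a crossing of two components the four corners lie in distinct regions, so the corner sum
is the incidence number.

Suppose that the components are disjoint, so that every crossing point `c` is a self-crossing. Let
`loopAt c` be the mod 2 winding number of the loop between the two passages through `c`. It is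
constant on regions, and its corner sum is 1 at `c` and 0 at every other crossing point. Corner sums
and incidence differ only at reducible crossing points, where two opposite corners share a region.
Pairing `w` with `loopAt c` therefore expresses `w c` by the values of `loopAt c` on the shared
regions at the reducible `d` with `w d ≠ 0`. If `w ≠ 0`, take a reducible `c` in its support, first
with the rightmost vertex of its component as far left as possible, then with the shortest loop. All
those values vanish, because the shared regions lie outside the loop
(`eq_zero_of_sum_incident_eq_zero`).

Winding numbers count intersections with a horizontal ray. Only three properties are used: they are
locally constant off the loop, they jump across it, and they vanish to the right of the component.
-/

open Filter Topology

/-! ### Ray parity of a single edge -/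

/-- The oriented area spanned by two vectors of the plane. -/
def crossProd (u v : ℂ) : ℝ := u.re * v.im - u.im * v.re

@[fun_prop]
theorem continuous_crossProd {X : Type*} [TopologicalSpace X] {f g : X → ℂ} (hf : Continuous f)
    (hg : Continuous g) : Continuous fun x => crossProd (f x) (g x) := by
  unfold crossProd; fun_prop

open Classical in
/-- The indicator, with values in `ZMod 2`, of a proposition. -/
noncomputable def ind (p : Prop) : ZMod 2 := if p then 1 else 0

theorem ind_true {p : Prop} (h : p) : ind p = 1 := if_pos h

theorem ind_false {p : Prop} (h : ¬ p) : ind p = 0 := if_neg h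

theorem ZMod.two_eq_zero_or_one (a : ZMod 2) : a = 0 ∨ a = 1 := by
  revert a; decide

theorem ZMod.two_add_self (a : ZMod 2) : a + a = 0 := by
  revert a; decide

theorem ZMod.two_add_eq_zero {a b : ZMod 2} : a + b = 0 ↔ a = b := by
  revert a b; decide

/-- The parity of the number of intersections of the edge `uv` with the rightward horizontal ray
that starts at `p`. -/
noncomputable def rayParity (u v p : ℂ) : ZMod 2 :=
  ind ((u.im ≤ p.im ∧ p.im < v.im ∧ 0 < crossProd (u - p) (v - p)) ∨
    (v.im ≤ p.im ∧ p.im < u.im ∧ crossProd (u - p) (v - p) < 0))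

theorem rayParity_self (u p : ℂ) : rayParity u u p = 0 := by
  refine ind_false ?_
  rintro (h | h) <;> linarith [h.1, h.2.1]

/-- A rightward ray that starts to the right of both endpoints misses the edge. This is the source
of all vanishing of winding numbers below. -/
theorem rayParity_eq_zero_of_re_le {u v p : ℂ} (hu : u.re ≤ p.re) (hv : v.re ≤ p.re) :
    rayParity u v p = 0 := by
  refine ind_false ?_
  unfold crossProd
  simp only [Complex.sub_re, Complex.sub_im]
  rintro (⟨h1, h2, h3⟩ | ⟨h1, h2, h3⟩)
  · nlinarith [mul_nonneg (sub_nonneg.2 hu) (sub_nonneg.2 h2.le),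
      mul_nonneg (sub_nonneg.2 hv) (sub_nonneg.2 h1)]
  · nlinarith [mul_nonneg (sub_nonneg.2 hu) (sub_nonneg.2 h1),
      mul_nonneg (sub_nonneg.2 hv) (sub_nonneg.2 h2.le)]

/-- The contribution of an endpoint `w` that makes `rayParity` locally constant. -/
noncomputable def endParity (x w p : ℂ) : ZMod 2 := ind (x.re < w.re ∧ p.im < w.im)

/-- `rayParity` corrected at the ends, with respect to the reference point `x`. -/
noncomputable def rayParityAt (x u v p : ℂ) : ZMod 2 :=
  rayParity u v p + (endParity x u p + endParity x v p)

theorem crossProd_sub_sub (u v x p : ℂ) : crossProd (u - p) (v - p) =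
    crossProd (u - x) (v - x) + crossProd (v - u) (p - x) := by
  simp only [crossProd, Complex.sub_re, Complex.sub_im]; ring

theorem eventually_lt_im {x u : ℂ} (h : x.im < u.im) : ∀ᶠ p in 𝓝 x, p.im < u.im :=
  Complex.continuous_im.continuousAt.eventually_lt continuousAt_const h

theorem eventually_gt_im {x u : ℂ} (h : u.im < x.im) : ∀ᶠ p in 𝓝 x, u.im < p.im :=
  continuousAt_const.eventually_lt Complex.continuous_im.continuousAt h

theorem eventually_crossProd_pos {x u v : ℂ} (h : 0 < crossProd (u - x) (v - x)) :
    ∀ᶠ p in 𝓝 x, 0 < crossProd (u - p) (v - p) :=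
  continuousAt_const.eventually_lt (g := fun p => crossProd (u - p) (v - p))
    (by fun_prop : Continuous _).continuousAt h

theorem eventually_crossProd_neg {x u v : ℂ} (h : crossProd (u - x) (v - x) < 0) :
    ∀ᶠ p in 𝓝 x, crossProd (u - p) (v - p) < 0 :=
  ContinuousAt.eventually_lt (f := fun p => crossProd (u - p) (v - p))
    (by fun_prop : Continuous _).continuousAt continuousAt_const h

theorem rayParityAt_comm (x u v p : ℂ) : rayParityAt x u v p = rayParityAt x v u p := by
  have : crossProd (u - p) (v - p) = - crossProd (v - p) (u - p) := by unfold crossProd; ring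
  unfold rayParityAt rayParity
  rw [this, add_comm (endParity x u p), or_comm]
  simp only [Left.neg_neg_iff, Left.neg_pos_iff]

theorem lineMap_re (u v : ℂ) (t : ℝ) :
    (AffineMap.lineMap u v t : ℂ).re = u.re + t * (v.re - u.re) := by
  simp [AffineMap.lineMap_apply]; ring

theorem lineMap_im (u v : ℂ) (t : ℝ) :
    (AffineMap.lineMap u v t : ℂ).im = u.im + t * (v.im - u.im) := by
  simp [AffineMap.lineMap_apply]; ring

theorem mem_segment_of_crossProd_eq_zero {x u v : ℂ} (h : crossProd (u - x) (v - x) = 0)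
    (hu : u.im < x.im) (hv : x.im < v.im) : x ∈ segment ℝ u v := by
  rw [segment_eq_image_lineMap]
  have h0 : v.im - u.im ≠ 0 := by linarith
  refine ⟨(x.im - u.im) / (v.im - u.im), ⟨?_, ?_⟩, ?_⟩
  · exact div_nonneg (by linarith) (by linarith)
  · rw [div_le_one] <;> linarith
  · simp only [crossProd, Complex.sub_re, Complex.sub_im] at h
    apply Complex.ext
    · rw [lineMap_re]; field_simp; linarith
    · rw [lineMap_im]; field_simp; ring

theorem mem_segment_of_im_eq {x u v : ℂ} (hu : u.im = x.im) (hv : v.im = x.im)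
    (h1 : u.re ≤ x.re) (h2 : x.re ≤ v.re) : x ∈ segment ℝ u v := by
  rcases h1.eq_or_lt with h | h
  · rw [show x = u from Complex.ext h.symm hu.symm]; exact left_mem_segment ℝ _ _
  rw [segment_eq_image_lineMap]
  have h0 : v.re - u.re ≠ 0 := by linarith
  refine ⟨(x.re - u.re) / (v.re - u.re), ⟨?_, ?_⟩, ?_⟩
  · exact div_nonneg (by linarith) (by linarith)
  · rw [div_le_one] <;> linarith
  · apply Complex.ext
    · rw [lineMap_re]; field_simp; ring
    · rw [lineMap_im, hu, hv]; ring

/-- Off the edge, the corrected ray parity is locally constant. -/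
theorem eventually_rayParityAt_eq {x u v : ℂ} (hx : x ∉ segment ℝ u v) :
    ∀ᶠ p in 𝓝 x, rayParityAt x u v p = rayParityAt x u v x := by
  -- The cases compare the heights of `u` and `v` with that of `x`. When just one endpoint is level
  -- with `x` and lies to its right, the ray count jumps as `p` passes that height, and so does the
  -- end correction.
  have key : ∀ u v : ℂ, x ∉ segment ℝ u v → u.im ≤ v.im →
      ∀ᶠ p in 𝓝 x, rayParityAt x u v p = rayParityAt x u v x := by
    clear hx u v
    intro u v hx huv
    have hux : u ≠ x := fun h => hx (h ▸ left_mem_segment ℝ u v)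
    have hvx : v ≠ x := fun h => hx (h ▸ right_mem_segment ℝ u v)
    rcases lt_trichotomy u.im x.im with hu | hu | hu <;>
    rcases lt_trichotomy v.im x.im with hv | hv | hv
    · filter_upwards [eventually_gt_im hu, eventually_gt_im hv] with p h1 h2
      simp only [rayParityAt, rayParity, endParity, hu.not_gt, hv.not_gt, h1.not_gt, h2.not_gt,
        and_false, false_and]
    · have hre : v.re ≠ x.re := fun h => hvx (Complex.ext h hv)
      rcases hre.lt_or_gt with hre | hre
      · have : 0 < crossProd (v - x) (u - x) := by
          simp only [crossProd, Complex.sub_re, Complex.sub_im, hv, sub_self, zero_mul, sub_zero]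
          exact mul_pos_of_neg_of_neg (by linarith) (by linarith)
        filter_upwards [eventually_gt_im hu, eventually_crossProd_pos this] with p h1 h2
        have h3 : ¬ 0 < crossProd (u - p) (v - p) := by unfold crossProd at *; linarith
        have h4 : ¬ 0 < crossProd (u - x) (v - x) := by unfold crossProd at *; linarith
        simp only [rayParityAt, rayParity, endParity, hu.not_gt, h1.not_gt, h3, h4, hre.not_gt,
          and_false, false_and]
      · have : crossProd (v - x) (u - x) < 0 := by
          simp only [crossProd, Complex.sub_re, Complex.sub_im, hv, sub_self, zero_mul, sub_zero]
          exact mul_neg_of_pos_of_neg (by linarith) (by linarith)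
        filter_upwards [eventually_gt_im hu, eventually_crossProd_neg this] with p h1 h2
        have h3 : 0 < crossProd (u - p) (v - p) := by unfold crossProd at *; linarith
        have h4 : 0 < crossProd (u - x) (v - x) := by unfold crossProd at *; linarith
        simp only [rayParityAt, rayParity, endParity, hu.not_gt, h1.not_gt, h3, h4, hre, hu.le,
          h1.le, and_false, false_and, or_false, true_and, and_true, hv, lt_irrefl]
        by_cases h : p.im < x.im <;> simp [ind, h]
        decide
    · have h0 : crossProd (u - x) (v - x) ≠ 0 := fun h =>
        hx (mem_segment_of_crossProd_eq_zero h hu hv)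
      rcases h0.lt_or_gt with h0 | h0
      · filter_upwards [eventually_gt_im hu, eventually_lt_im hv, eventually_crossProd_neg h0]
          with p h1 h2 h3
        simp only [rayParityAt, rayParity, endParity, hu.not_gt, h1.not_gt, h0.not_gt, h3.not_gt,
          hv, h2, and_false, false_and]
      · filter_upwards [eventually_gt_im hu, eventually_lt_im hv, eventually_crossProd_pos h0]
          with p h1 h2 h3
        simp only [rayParityAt, rayParity, endParity, hu.not_gt, h1.not_gt, h0, h3, hu.le, h1.le,
          hv, h2, and_false, false_and]
    · linarith
    -- A horizontal edge that misses `x` has both endpoints on the same side of `x`, so the two end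
    -- corrections cancel; the ray count itself is 0.
    · have hre : (x.re < u.re ∧ x.re < v.re) ∨ ¬ x.re < u.re ∧ ¬ x.re < v.re := by
        by_contra hcon
        rcases le_or_gt u.re x.re with h | h <;> rcases le_or_gt v.re x.re with h' | h'
        · exact hcon (Or.inr ⟨h.not_gt, h'.not_gt⟩)
        · exact hx (mem_segment_of_im_eq hu hv h h'.le)
        · exact hx (segment_symm ℝ u v ▸ mem_segment_of_im_eq hv hu h' h.le)
        · exact hcon (Or.inl ⟨h, h'⟩)
      refine Eventually.of_forall fun p => ?_
      have h1 : ∀ p, rayParity u v p = 0 := fun p => ind_false (by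
        rintro (h | h) <;> linarith [h.1, h.2.1])
      rcases hre with hre | hre <;>
        simp [rayParityAt, h1, endParity, hre, hu, hv, ZMod.two_add_self]
    · have hre : u.re ≠ x.re := fun h => hux (Complex.ext h hu)
      rcases hre.lt_or_gt with hre | hre
      · have : crossProd (u - x) (v - x) < 0 := by
          simp only [crossProd, Complex.sub_re, Complex.sub_im, hu, sub_self, zero_mul, sub_zero]
          exact mul_neg_of_neg_of_pos (by linarith) (by linarith)
        filter_upwards [eventually_lt_im hv, eventually_crossProd_neg this] with p h1 h2
        simp only [rayParityAt, rayParity, endParity, h1, hv, h2.not_gt, this.not_gt, hre.not_gt,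
          and_false, false_and, h1.not_ge, hv.not_ge]
      · have : 0 < crossProd (u - x) (v - x) := by
          simp only [crossProd, Complex.sub_re, Complex.sub_im, hu, sub_self, zero_mul, sub_zero]
          exact mul_pos (by linarith) (by linarith)
        filter_upwards [eventually_lt_im hv, eventually_crossProd_pos this] with p h1 h2
        simp only [rayParityAt, rayParity, endParity, h1, hv, h2, this, hre, hu,
          and_false, false_and, h1.not_ge, hv.not_ge, true_and, and_true, or_false, le_refl,
          lt_irrefl]
        by_cases h : p.im < x.im
        · simp [ind, h, h.not_ge]
        · simp [ind, h, not_lt.1 h]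
    · linarith
    · linarith
    · filter_upwards [eventually_lt_im hu, eventually_lt_im hv] with p h1 h2
      simp only [rayParityAt, rayParity, endParity, hu, hv, h1, h2, hu.not_ge, hv.not_ge,
        h1.not_ge, h2.not_ge, false_and]
  rcases le_total u.im v.im with h | h
  · exact key u v hx h
  · rw [segment_symm] at hx
    simpa only [rayParityAt_comm x v u] using key v u hx h

/-- The corrected ray parity changes across the interior of the edge. -/
theorem eventually_rayParityAt_add {x u v : ℂ} (huv : u ≠ v) {t : ℝ} (ht : t ∈ Set.Ioo (0 : ℝ) 1)
    (hx : AffineMap.lineMap u v t = x) : ∃ a : ZMod 2, ∀ᶠ p in 𝓝 x, crossProd (v - u) (p - x) ≠ 0 →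
      rayParityAt x u v p = a + ind (0 < crossProd (v - u) (p - x)) := by
  have hxr : x.re = u.re + t * (v.re - u.re) := by
    rw [← hx, lineMap_re]
  have hxi : x.im = u.im + t * (v.im - u.im) := by
    rw [← hx, lineMap_im]
  have hc : crossProd (u - x) (v - x) = 0 := by
    simp only [crossProd, Complex.sub_re, Complex.sub_im, hxr, hxi]; ring
  obtain ⟨ht0, ht1⟩ := ht
  rcases lt_trichotomy u.im v.im with h | h | h
  · have hu : u.im < x.im := by nlinarith
    have hv : x.im < v.im := by nlinarith
    refine ⟨endParity x v x, ?_⟩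
    filter_upwards [eventually_gt_im hu, eventually_lt_im hv] with p h1 h2 _
    simp only [rayParityAt, rayParity, endParity, crossProd_sub_sub u v x p, hc, h1.not_gt, h1.le,
      h2, hv, true_and, false_and, and_false, or_false, zero_add, and_true,
      ind_false not_false]
    exact add_comm _ _
  -- No ray counts a horizontal edge, so here the whole jump comes from the correction at the right
  -- endpoint.
  · have hui : u.im = x.im := by rw [hxi, h]; ring
    have hvi : v.im = x.im := by rw [hxi, h]; ring
    have h1 : ∀ p, rayParity u v p = 0 := fun p => ind_false (by
      rintro (h | h) <;> linarith [h.1, h.2.1])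
    have hne : u.re ≠ v.re := fun h' => huv (Complex.ext h' h)
    have hcr : ∀ p, crossProd (v - u) (p - x) = (v.re - u.re) * (p.im - x.im) := by
      intro p; simp [crossProd, h]
    rcases hne.lt_or_gt with hr | hr
    · have e1 : u.re < x.re := by nlinarith
      have e2 : x.re < v.re := by nlinarith
      refine ⟨1, Eventually.of_forall fun p hp => ?_⟩
      rw [hcr] at hp ⊢
      have hp' : p.im - x.im ≠ 0 := right_ne_zero_of_mul hp
      have e4 : 0 < v.re - u.re := by linarith
      simp only [rayParityAt, h1, endParity, e1.not_gt, e2, hvi, false_and, true_and,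
        mul_pos_iff_of_pos_left e4]
      rcases hp'.lt_or_gt with e | e
      · rw [ind_true (by linarith : p.im < x.im), ind_false e.not_gt]; simp [ind]
      · rw [ind_false (by linarith : ¬ p.im < x.im), ind_true e]; simp [ind]; decide
    · have e1 : x.re < u.re := by nlinarith
      have e2 : v.re < x.re := by nlinarith
      refine ⟨0, Eventually.of_forall fun p hp => ?_⟩
      rw [hcr] at hp ⊢
      have hp' : p.im - x.im ≠ 0 := right_ne_zero_of_mul hp
      have e4 : 0 < u.re - v.re := by linarith
      have e5 : (v.re - u.re) * (p.im - x.im) = (u.re - v.re) * (x.im - p.im) := by ring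
      simp only [rayParityAt, h1, endParity, e2.not_gt, e1, hui, false_and, true_and, e5,
        mul_pos_iff_of_pos_left e4, sub_pos, ind_false not_false, add_zero]
  · have hu : x.im < u.im := by nlinarith
    have hv : v.im < x.im := by nlinarith
    refine ⟨endParity x u x + 1, ?_⟩
    filter_upwards [eventually_lt_im hu, eventually_gt_im hv] with p h1 h2 h3
    simp only [rayParityAt, rayParity, endParity, crossProd_sub_sub u v x p, hc, h2.not_gt, h2.le,
      h1, hu, true_and, false_and, and_false, false_or, zero_add, and_true,
      ind_false not_false, h1.not_ge]
    rcases h3.lt_or_gt with e | e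
    · rw [ind_true e, ind_false e.not_gt]; ring
    · rw [ind_false e.not_gt, ind_true e, zero_add, add_zero, add_assoc, ZMod.two_add_self,
        add_zero]

theorem exists_eq_smul_of_crossProd_eq_zero {u v : ℂ} (hu : u ≠ 0) (h : crossProd u v = 0) :
    ∃ l : ℝ, v = l • u := by
  unfold crossProd at h
  by_cases hr : u.re = 0
  · have hi : u.im ≠ 0 := fun hi => hu (Complex.ext hr hi)
    refine ⟨v.im / u.im, Complex.ext ?_ ?_⟩
    · simp only [hr, Complex.real_smul, Complex.mul_re, Complex.ofReal_re, mul_zero,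
        Complex.ofReal_im, zero_mul, sub_zero]
      rw [hr, zero_mul, zero_sub, neg_eq_zero] at h
      exact (mul_eq_zero.1 h).resolve_left hi
    · simp [hi]
  · refine ⟨v.re / u.re, Complex.ext ?_ ?_⟩
    · simp [hr]
    · simp only [Complex.real_smul, Complex.mul_im, Complex.ofReal_re, Complex.ofReal_im, zero_mul,
        add_zero]
      field_simp; linarith

theorem crossProd_smul_right (u v : ℂ) (a : ℝ) : crossProd u (a • v) = a * crossProd u v := by
  simp [crossProd]; ring

theorem crossProd_add_right (u v w : ℂ) : crossProd u (v + w) = crossProd u v + crossProd u w := by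
  simp [crossProd]; ring

theorem crossProd_self (u : ℂ) : crossProd u u = 0 := by simp [crossProd]; ring

theorem crossProd_comm (u v : ℂ) : crossProd u v = - crossProd v u := by
  unfold crossProd; ring

/-! ### Polygons in general position -/

namespace LinkProjection

variable {n : ℕ} (P : LinkProjection n)

instance (i : Fin n) : NeZero (P.size i) := ⟨by have := P.three_le_size i; omega⟩

variable {P}

/-- The first vertex of an edge of the polygons. -/
def src (e : P.Edge) : ℂ := P.vertex e.1 e.2

/-- The edge that follows a given edge. -/
def nxt (e : P.Edge) : P.Edge := ⟨e.1, e.2 + 1⟩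

/-- The last vertex of an edge of the polygons. -/
def dst (e : P.Edge) : ℂ := src (nxt e)

/-- An edge of the polygons, as a subset of the plane. -/
def seg (e : P.Edge) : Set ℂ := segment ℝ (src e) (dst e)

/-- The direction of an edge. -/
def dir (e : P.Edge) : ℂ := dst e - src e

/-- The affine parametrization of an edge. -/
noncomputable def pt (e : P.Edge) (t : ℝ) : ℂ := src e + t • dir e

variable (P) in
/-- The union of the polygons. -/
def polygons : Set ℂ := ⋃ e : P.Edge, seg e

theorem nxt_injective : Function.Injective (nxt : P.Edge → P.Edge) := by
  rintro ⟨i, k⟩ ⟨j, l⟩ h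
  simp only [nxt, Sigma.mk.injEq] at h
  obtain ⟨rfl, h⟩ := h
  simpa using h

theorem natCast_ne_zero (i : Fin n) {m : ℕ} (h0 : 0 < m) (h : m < 3) :
    (m : ZMod (P.size i)) ≠ 0 := by
  intro hm
  rw [ZMod.natCast_eq_zero_iff] at hm
  have := Nat.le_of_dvd h0 hm
  have := P.three_le_size i
  omega

theorem nxt_ne (e : P.Edge) : nxt e ≠ e := by
  obtain ⟨i, k⟩ := e
  simp only [nxt, ne_eq, Sigma.mk.injEq, heq_eq_eq, true_and, add_eq_left]
  exact_mod_cast natCast_ne_zero (P := P) i one_pos (by norm_num)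

theorem nxt_nxt_ne (e : P.Edge) : nxt (nxt e) ≠ e := by
  obtain ⟨i, k⟩ := e
  have := natCast_ne_zero (P := P) i two_pos (by norm_num)
  rw [Nat.cast_two, ← one_add_one_eq_two] at this
  intro h
  simp only [nxt, Sigma.mk.injEq, heq_eq_eq, true_and] at h
  exact this (add_eq_left.1 ((add_assoc k 1 1).symm.trans h))

theorem pt_zero (e : P.Edge) : pt e 0 = src e := by simp [pt]

theorem pt_one (e : P.Edge) : pt e 1 = dst e := by simp [pt, dir]

theorem pt_add (e : P.Edge) (s t : ℝ) : pt e (s + t) = pt e s + t • dir e := by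
  simp only [pt, add_smul]; ring

theorem lineMap_eq_pt (e : P.Edge) (t : ℝ) : AffineMap.lineMap (src e) (dst e) t = pt e t := by
  rw [AffineMap.lineMap_apply_module', pt, dir, add_comm]

@[fun_prop]
theorem continuous_pt (e : P.Edge) : Continuous (pt e) := by unfold pt; fun_prop

theorem mem_seg_iff {e : P.Edge} {x : ℂ} : x ∈ seg e ↔ ∃ t ∈ Set.Icc (0 : ℝ) 1, pt e t = x := by
  rw [seg, segment_eq_image_lineMap, Set.mem_image]
  simp only [lineMap_eq_pt]

theorem pt_mem_seg (e : P.Edge) {t : ℝ} (ht : t ∈ Set.Icc (0 : ℝ) 1) : pt e t ∈ seg e :=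
  mem_seg_iff.2 ⟨t, ht, rfl⟩

theorem src_mem_seg (e : P.Edge) : src e ∈ seg e := left_mem_segment ..

theorem isClosed_seg (e : P.Edge) : IsClosed (seg e) := by
  rw [seg, segment_eq_image_lineMap]
  exact (isCompact_Icc.image (by fun_prop)).isClosed

theorem seg_subset_polygons (e : P.Edge) : seg e ⊆ P.polygons := Set.subset_iUnion _ _

theorem eq_or_eq_nxt_of_src_mem {e f : P.Edge} (h : src e ∈ seg f) : e = f ∨ e = nxt f :=
  P.vertex_generic e.1 e.2 f.1 f.2 h

theorem src_injective : Function.Injective (src : P.Edge → ℂ) := by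
  intro e f h
  have h1 := eq_or_eq_nxt_of_src_mem (h ▸ src_mem_seg f : src e ∈ seg f)
  have h2 := eq_or_eq_nxt_of_src_mem (h ▸ src_mem_seg e : src f ∈ seg e)
  rcases h1 with h1 | h1
  · exact h1
  rcases h2 with h2 | h2
  · exact h2.symm
  · exact absurd (h1.trans (congrArg nxt h2)).symm (nxt_nxt_ne e)

theorem dir_ne_zero (e : P.Edge) : dir e ≠ 0 :=
  sub_ne_zero.2 fun h => nxt_ne e (src_injective h)

theorem pt_injective (e : P.Edge) : Function.Injective (pt e) := by
  intro s t h
  simpa [pt, dir_ne_zero e] using h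

/-- A point that is no vertex. -/
def NotVertex (P : LinkProjection n) (x : ℂ) : Prop := ∀ e : P.Edge, x ≠ src e

theorem NotVertex.exists_pt {x : ℂ} (hx : NotVertex P x) {e : P.Edge} (he : x ∈ seg e) :
    ∃ t ∈ Set.Ioo (0 : ℝ) 1, pt e t = x := by
  obtain ⟨t, ⟨h0, h1⟩, rfl⟩ := mem_seg_iff.1 he
  refine ⟨t, ⟨h0.lt_of_ne ?_, h1.lt_of_ne ?_⟩, rfl⟩
  · rintro rfl; exact hx e (pt_zero e)
  · rintro rfl; exact hx (nxt e) (pt_one e)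

/-- Followed forwards from the common point, `f` runs backwards along `e`. Either `f` stops on `e`,
or it reaches the start of `e`; in both cases a vertex lies on the other edge, and genericity
identifies it. -/
theorem nxt_eq_of_smul_neg {e f : P.Edge} (hef : e ≠ f) {s t l : ℝ}
    (hs : s ∈ Set.Ioo (0 : ℝ) 1) (ht : t ∈ Set.Ioo (0 : ℝ) 1) (h : pt e s = pt f t)
    (hl : dir f = l • dir e) (hl0 : l < 0) : nxt f = e := by
  have hd : dst f = pt e (s + (1 - t) * l) := by
    rw [pt_add, h, mul_smul, ← hl, ← pt_add, ← pt_one]; congr 1; ring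
  by_cases hc : 0 ≤ s + (1 - t) * l
  · have : dst f ∈ seg e := hd ▸ pt_mem_seg e ⟨hc, by nlinarith [hs.2, ht.2]⟩
    rcases eq_or_eq_nxt_of_src_mem this with h | h
    · exact h
    · exact absurd (nxt_injective h).symm hef
  · have he : src e = pt f (t - s / l) := by
      rw [sub_eq_add_neg, pt_add, ← h, hl, smul_smul, ← pt_add, ← pt_zero]
      congr 1; rw [neg_mul, div_mul_cancel₀ _ hl0.ne]; ring
    have h1 : t - s / l < 1 := by
      rw [sub_lt_comm, lt_div_iff_of_neg hl0]; linarith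
    have h2 : 0 < -(s / l) := by rw [← div_neg]; exact div_pos hs.1 (by linarith)
    have : src e ∈ seg f := he ▸ pt_mem_seg f ⟨by linarith [ht.1], h1.le⟩
    rcases eq_or_eq_nxt_of_src_mem this with h | h
    · exact absurd h hef
    · exact h.symm

/-- Parallel edges through a common interior point overlap, so a vertex of one lies on the other.
With opposite directions each edge would follow the other, which needs a 2-gon. With equal
directions the later of the two starting points would lie on the other edge before its end. -/
theorem crossProd_dir_ne_zero {e f : P.Edge} (hef : e ≠ f) {s t : ℝ}
    (hs : s ∈ Set.Ioo (0 : ℝ) 1) (ht : t ∈ Set.Ioo (0 : ℝ) 1) (h : pt e s = pt f t) :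
    crossProd (dir e) (dir f) ≠ 0 := by
  intro hc
  obtain ⟨l, hl⟩ := exists_eq_smul_of_crossProd_eq_zero (dir_ne_zero e) hc
  have hl0 : l ≠ 0 := by rintro rfl; exact dir_ne_zero f (by simpa using hl)
  have hl' : dir e = l⁻¹ • dir f := by rw [hl, smul_smul, inv_mul_cancel₀ hl0, one_smul]
  rcases hl0.lt_or_gt with hn | hp
  · have h1 := nxt_eq_of_smul_neg hef hs ht h hl hn
    have h2 := nxt_eq_of_smul_neg hef.symm ht hs h.symm hl' (inv_lt_zero.2 hn)
    exact nxt_nxt_ne e (by rw [h2, h1])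
  · have he : src e = pt f (t + -s * l⁻¹) := by
      rw [pt_add, ← h, mul_smul, ← hl', ← pt_add, ← pt_zero]; congr 1; ring
    have hf : src f = pt e (s + -t * l) := by
      rw [pt_add, h, mul_smul, ← hl, ← pt_add, ← pt_zero]; congr 1; ring
    have hli := inv_pos.2 hp
    rcases le_or_gt 0 (s + -t * l) with hc | hc
    · have hlt : s + -t * l < 1 := by nlinarith [hs.2, mul_pos ht.1 hp]
      rcases eq_or_eq_nxt_of_src_mem (hf ▸ pt_mem_seg e ⟨hc, hlt.le⟩ : src f ∈ seg e) with h | h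
      · exact hef h.symm
      · rw [h, ← dst, ← pt_one] at hf
        exact hlt.ne' (pt_injective _ hf)
    · have hlt : t + -s * l⁻¹ < 1 := by nlinarith [ht.2, mul_pos hs.1 hli]
      have hge : 0 ≤ t + -s * l⁻¹ := by
        have : (t + -s * l⁻¹) * l = -(s + -t * l) := by field_simp; ring
        nlinarith
      rcases eq_or_eq_nxt_of_src_mem (he ▸ pt_mem_seg f ⟨hge, hlt.le⟩ : src e ∈ seg f) with h | h
      · exact hef h
      · rw [h, ← dst, ← pt_one] at he
        exact hlt.ne' (pt_injective _ he)

/-- Consecutive edges that are parallel have the same direction. -/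
theorem exists_dir_nxt_eq_smul {e : P.Edge} (h : crossProd (dir e) (dir (nxt e)) = 0) :
    ∃ l : ℝ, 0 < l ∧ dir (nxt e) = l • dir e := by
  obtain ⟨l, hl⟩ := exists_eq_smul_of_crossProd_eq_zero (dir_ne_zero e) h
  have hl0 : l ≠ 0 := by rintro rfl; exact dir_ne_zero (nxt e) (by simpa using hl)
  refine ⟨l, lt_of_not_ge fun hle => ?_, hl⟩
  have hneg := lt_of_le_of_ne hle hl0
  -- If the path doubled back at the vertex, the far end of the shorter edge would lie on the longer
  -- one.
  rcases le_or_gt (-1) l with h1 | h1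
  · have : dst (nxt e) = pt e (1 + l) := by
      rw [pt_add, pt_one, ← hl]; simp only [dir, dst]; ring
    rcases eq_or_eq_nxt_of_src_mem
      (this ▸ pt_mem_seg e ⟨by linarith, by linarith⟩ : dst (nxt e) ∈ seg e) with h2 | h2
    · exact nxt_nxt_ne e h2
    · exact nxt_ne _ h2
  · have hl' : dir e = l⁻¹ • dir (nxt e) := by rw [hl, smul_smul, inv_mul_cancel₀ hl0, one_smul]
    have : src e = pt (nxt e) (-l⁻¹) := by
      rw [pt, neg_smul, ← hl']; simp only [dir, dst]; ring
    have h3 : -l⁻¹ ≤ 1 := by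
      rw [← inv_neg]; exact inv_le_one_of_one_le₀ (by linarith)
    have h4 : 0 ≤ -l⁻¹ := by rw [← inv_neg]; exact inv_nonneg.2 (by linarith)
    rcases eq_or_eq_nxt_of_src_mem
      (this ▸ pt_mem_seg (nxt e) ⟨h4, h3⟩ : src e ∈ seg (nxt e)) with h2 | h2
    · exact nxt_ne e h2.symm
    · exact nxt_nxt_ne e h2.symm

theorem eq_or_eq_of_mem_seg {e f g : P.Edge} (hef : e ≠ f) {x : ℂ} (he : x ∈ seg e)
    (hf : x ∈ seg f) (hg : x ∈ seg g) : g = e ∨ g = f := by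
  by_contra! h
  have := P.no_triple e f g hef h.1.symm h.2.symm
  exact Set.notMem_empty x (this ▸ ⟨⟨he, hf⟩, hg⟩)

/-- There are finitely many edges and they are closed, so near `x` only the edges through `x` are
visible. -/
theorem eventually_mem_seg (x : ℂ) : ∀ᶠ p in 𝓝 x, ∀ e : P.Edge, p ∈ seg e → x ∈ seg e := by
  refine eventually_all.2 fun e => ?_
  by_cases h : x ∈ seg e
  · exact Eventually.of_forall fun _ _ => h
  · filter_upwards [(isClosed_seg e).isOpen_compl.mem_nhds h] with p hp hp'
    exact absurd hp' hp

end LinkProjection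

/-! ### Parametrized components and winding numbers of loops -/

namespace LinkProjection

variable {n : ℕ} {P : LinkProjection n}

/-- The truncation of a real number to the unit interval. -/
noncomputable def clamp (x : ℝ) : ℝ := max 0 (min 1 x)

@[fun_prop]
theorem continuous_clamp : Continuous clamp := by unfold clamp; fun_prop

theorem clamp_mem (x : ℝ) : clamp x ∈ Set.Icc (0 : ℝ) 1 :=
  ⟨le_max_left _ _, max_le zero_le_one (min_le_left _ _)⟩

theorem clamp_of_mem {x : ℝ} (h : x ∈ Set.Icc (0 : ℝ) 1) : clamp x = x := by
  rw [clamp, min_eq_right h.2, max_eq_right h.1]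

theorem clamp_of_nonpos {x : ℝ} (h : x ≤ 0) : clamp x = 0 := by
  rw [clamp, min_eq_right (by linarith), max_eq_left h]

theorem clamp_of_one_le {x : ℝ} (h : 1 ≤ x) : clamp x = 1 := by
  rw [clamp, min_eq_left h, max_eq_right zero_le_one]

theorem clamp_mono {x y : ℝ} (h : x ≤ y) : clamp x ≤ clamp y := by unfold clamp; gcongr

theorem lt_clamp_iff {x t : ℝ} (h0 : 0 ≤ t) (h1 : t < 1) : t < clamp x ↔ t < x := by
  simp [clamp, h0.not_gt, h1]

theorem clamp_lt_iff {x t : ℝ} (h0 : 0 < t) (h1 : t ≤ 1) : clamp x < t ↔ x < t := by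
  simp [clamp, h0, h1.not_gt]

variable (P) in
theorem exists_rightmost (i : Fin n) : ∃ b : ZMod (P.size i), ∀ k, (P.vertex i k).re ≤
    (P.vertex i b).re :=
  Finite.exists_max fun k => (P.vertex i k).re

variable (P) in
/-- A vertex of a component with maximal abscissa. -/
noncomputable def rightmost (i : Fin n) : ZMod (P.size i) := (exists_rightmost P i).choose

variable (P) in
/-- The edges of a component, numbered from the rightmost vertex. -/
noncomputable def edge (i : Fin n) (k : ℕ) : P.Edge := ⟨i, P.rightmost i + k⟩

/-- The number of an edge, counted from the rightmost vertex. -/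
noncomputable def idx (e : P.Edge) : ℕ := (e.2 - P.rightmost e.1).val

theorem re_le_rightmost (e : P.Edge) : (src e).re ≤ (src (P.edge e.1 0)).re := by
  simpa [edge, src, rightmost] using (exists_rightmost P e.1).choose_spec e.2

theorem nxt_edge (i : Fin n) (k : ℕ) : nxt (P.edge i k) = P.edge i (k + 1) := by
  simp only [nxt, edge, Nat.cast_add, Nat.cast_one, Sigma.mk.injEq, heq_eq_eq, true_and]
  exact add_assoc _ _ _

theorem edge_size (i : Fin n) : P.edge i (P.size i) = P.edge i 0 := by simp [edge]

theorem idx_lt (e : P.Edge) : idx e < P.size e.1 := ZMod.val_lt _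

theorem edge_idx (e : P.Edge) : P.edge e.1 (idx e) = e := by
  obtain ⟨i, k⟩ := e
  simp [edge, idx]

theorem edge_eq_edge {i : Fin n} {k l : ℕ} (hk : k < P.size i) (hl : l < P.size i)
    (h : P.edge i k = P.edge i l) : k = l := by
  simp only [edge, Sigma.mk.injEq, heq_eq_eq, true_and, add_right_inj] at h
  rw [ZMod.natCast_eq_natCast_iff'] at h
  rwa [Nat.mod_eq_of_lt hk, Nat.mod_eq_of_lt hl] at h

/-- The parametrization of a component, which runs through edge `k` from time `k` to `k + 1`. -/
noncomputable def curve (P : LinkProjection n) (i : Fin n) (T : ℝ) : ℂ :=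
  src (P.edge i 0) + ∑ k ∈ Finset.range (P.size i), clamp (T - k) • dir (P.edge i k)

@[fun_prop]
theorem continuous_curve (i : Fin n) : Continuous (P.curve i) := by unfold curve; fun_prop

/-- At time `m + t` the edges before `m` are clamped to their ends and those after `m` to their
starts, so the sum telescopes. The identity as `g` evaluates `curve`; `endParity` as `g` makes the
end corrections of a loop cancel. -/
theorem sum_clamp_telescope {G : Type*} [AddCommGroup G] (g : ℂ → G) (i : Fin n) {m : ℕ}
    (hm : m < P.size i) {t : ℝ} (ht : t ∈ Set.Icc (0 : ℝ) 1) :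
    ∑ k ∈ Finset.range (P.size i), (g (pt (P.edge i k) (clamp (m + t - k))) - g (src (P.edge i k)))
      = g (pt (P.edge i m) t) - g (src (P.edge i 0)) := by
  have key : ∀ M : ℕ, ∑ k ∈ Finset.range M,
      (g (pt (P.edge i k) (clamp (m + t - k))) - g (src (P.edge i k))) =
      (if M ≤ m then g (src (P.edge i M)) else g (pt (P.edge i m) t)) - g (src (P.edge i 0)) := by
    intro M
    induction M with
    | zero => simp
    | succ M ih =>
      rw [Finset.sum_range_succ, ih]
      rcases lt_trichotomy M m with h | h | h
      · have : (M : ℝ) + 1 ≤ m := by exact_mod_cast h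
        rw [if_pos h.le, if_pos (by omega), clamp_of_one_le (by linarith [ht.1]), pt_one, dst,
          nxt_edge]
        abel
      · subst h
        rw [if_pos le_rfl, if_neg (by omega), add_sub_cancel_left, clamp_of_mem ht]
        abel
      · have : (m : ℝ) + 1 ≤ M := by exact_mod_cast h
        rw [if_neg (by omega), if_neg (by omega), clamp_of_nonpos (by linarith [ht.2]), pt_zero]
        abel
  rw [key, if_neg (by omega)]

theorem curve_add (i : Fin n) {m : ℕ} (hm : m < P.size i) {t : ℝ} (ht : t ∈ Set.Icc (0 : ℝ) 1) :
    P.curve i (m + t) = pt (P.edge i m) t := by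
  have h := sum_clamp_telescope id i hm ht
  simp only [id, pt, add_sub_cancel_left] at h
  rw [curve, h, pt]
  ring

theorem exists_eq_add {N : ℕ} (hN : 0 < N) {T : ℝ} (hT : T ∈ Set.Icc (0 : ℝ) N) :
    ∃ m < N, ∃ t ∈ Set.Icc (0 : ℝ) 1, T = m + t := by
  rcases hT.2.lt_or_eq with h | h
  · refine ⟨⌊T⌋₊, (Nat.floor_lt hT.1).2 h, T - ⌊T⌋₊, ⟨?_, ?_⟩, by ring⟩
    · linarith [Nat.floor_le hT.1]
    · linarith [Nat.lt_floor_add_one T]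
  · refine ⟨N - 1, by omega, 1, by simp, ?_⟩
    rw [h, Nat.cast_sub hN]; simp

theorem exists_eq_add_lt {N : ℕ} {T : ℝ} (hT : T ∈ Set.Ico (0 : ℝ) N) :
    ∃ m < N, ∃ t ∈ Set.Ico (0 : ℝ) 1, T = m + t := by
  refine ⟨⌊T⌋₊, (Nat.floor_lt hT.1).2 hT.2, T - ⌊T⌋₊, ⟨?_, ?_⟩, by ring⟩
  · linarith [Nat.floor_le hT.1]
  · linarith [Nat.lt_floor_add_one T]

theorem size_pos (i : Fin n) : 0 < P.size i := by have := P.three_le_size i; omega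

theorem curve_zero (i : Fin n) : P.curve i 0 = src (P.edge i 0) := by
  simpa [pt_zero] using curve_add (P := P) i (size_pos i) (t := 0) (by simp)

theorem curve_size (i : Fin n) : P.curve i (P.size i) = P.curve i 0 := by
  have := size_pos (P := P) i
  have h := curve_add (P := P) i (m := P.size i - 1) (by omega) (t := 1) (by simp)
  rw [pt_one, dst, nxt_edge, Nat.sub_add_cancel this, edge_size, Nat.cast_sub this] at h
  rw [curve_zero, ← h]; simp

theorem sum_clamp_eq (g : ℂ → ZMod 2) (i : Fin n) {T : ℝ} (hT : T ∈ Set.Icc (0 : ℝ) (P.size i)) :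
    ∑ k ∈ Finset.range (P.size i), (g (pt (P.edge i k) (clamp (T - k))) - g (src (P.edge i k)))
      = g (P.curve i T) - g (src (P.edge i 0)) := by
  obtain ⟨m, hm, t, ht, rfl⟩ := exists_eq_add (size_pos i) hT
  rw [sum_clamp_telescope g i hm ht, curve_add i hm ht]

/-- The mod 2 winding number around a point of the part of a component from time `S` to time `T`
(if it is a closed curve). -/
noncomputable def loopParity (P : LinkProjection n) (i : Fin n) (S T : ℝ) (p : ℂ) : ZMod 2 :=
  ∑ k ∈ Finset.range (P.size i),
    rayParity (pt (P.edge i k) (clamp (S - k))) (pt (P.edge i k) (clamp (T - k))) p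

/-- The part of a component from time `S` to time `T` is a closed curve. -/
structure IsLoop (P : LinkProjection n) (i : Fin n) (S T : ℝ) : Prop where
  nonneg : 0 ≤ S
  le : S ≤ T
  le_size : T ≤ P.size i
  curve_eq : P.curve i S = P.curve i T

variable {i : Fin n} {S T : ℝ}

theorem isLoop_size (i : Fin n) : IsLoop P i 0 (P.size i) :=
  ⟨le_rfl, Nat.cast_nonneg _, le_rfl, (curve_size i).symm⟩

/-- Summed over all pieces, the corrections at the starts and at the ends differ by those at `curve
S` and `curve T`, which agree. Local statements about `rayParityAt` thus carry over to the whole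
loop. -/
theorem IsLoop.loopParity_eq (h : IsLoop P i S T) (x p : ℂ) : P.loopParity i S T p =
    ∑ k ∈ Finset.range (P.size i),
      rayParityAt x (pt (P.edge i k) (clamp (S - k))) (pt (P.edge i k) (clamp (T - k))) p := by
  simp only [loopParity, rayParityAt, Finset.sum_add_distrib, left_eq_add]
  have h1 := sum_clamp_eq (P := P) (endParity x · p) i ⟨h.nonneg, h.le.trans h.le_size⟩
  have h2 := sum_clamp_eq (P := P) (endParity x · p) i ⟨h.nonneg.trans h.le, h.le_size⟩
  rw [Finset.sum_sub_distrib] at h1 h2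
  rw [ZMod.two_add_eq_zero]
  rw [sub_eq_iff_eq_add] at h1 h2
  rw [h1, h2, h.curve_eq]

/-- Strictness in `hlt` excludes the edges outside the time interval: their pieces degenerate to
vertices that need not lie on the loop. -/
theorem pt_mem_curve_image {k : ℕ} (hk : k < P.size i) {t : ℝ} (hlt : clamp (S - k) < clamp (T - k))
    (ht : t ∈ Set.Icc (clamp (S - k)) (clamp (T - k))) : pt (P.edge i k) t ∈
      P.curve i '' Set.Icc S T := by
  have h0 : 0 ≤ t := (clamp_mem _).1.trans ht.1
  have h1 : t ≤ 1 := ht.2.trans (clamp_mem _).2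
  refine ⟨k + t, ⟨?_, ?_⟩, curve_add i hk ⟨h0, h1⟩⟩
  · by_contra hc
    have h2 : clamp (S - k) ≤ t := ht.1
    rcases h1.lt_or_eq with h1 | h1
    · exact absurd ((lt_clamp_iff h0 h1).2 (by linarith : t < S - k)) h2.not_gt
    · have : clamp (S - k) = 1 := clamp_of_one_le (by linarith)
      linarith [(clamp_mem (T - k)).2]
  · by_contra hc
    have h2 : t ≤ clamp (T - k) := ht.2
    rcases h0.lt_or_eq with h0 | h0
    · exact absurd ((clamp_lt_iff h0 h1).2 (by linarith : T - k < t)) h2.not_gt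
    · have : clamp (T - k) = 0 := clamp_of_nonpos (by linarith)
      linarith [(clamp_mem (S - k)).1]

theorem segment_pt_subset (e : P.Edge) {a b : ℝ} (hab : a ≤ b) :
    segment ℝ (pt e a) (pt e b) ⊆ pt e '' Set.Icc a b := by
  rw [segment_eq_image_lineMap]
  rintro _ ⟨s, hs, rfl⟩
  refine ⟨a + s * (b - a), ⟨?_, ?_⟩, ?_⟩
  · nlinarith [mul_nonneg hs.1 (sub_nonneg.2 hab)]
  · nlinarith [mul_nonneg (sub_nonneg.2 hs.2) (sub_nonneg.2 hab)]
  · rw [AffineMap.lineMap_apply_module', pt_add, mul_smul]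
    simp only [pt, sub_smul, smul_sub, smul_add]
    ring

/-- The mod 2 winding number is locally constant off the loop. -/
theorem IsLoop.eventually_loopParity_eq (h : IsLoop P i S T) {x : ℂ}
    (hx : x ∉ P.curve i '' Set.Icc S T) :
    ∀ᶠ p in 𝓝 x, P.loopParity i S T p = P.loopParity i S T x := by
  have : ∀ᶠ p in 𝓝 x, ∀ k ∈ Finset.range (P.size i),
      rayParityAt x (pt (P.edge i k) (clamp (S - k))) (pt (P.edge i k) (clamp (T - k))) p =
      rayParityAt x (pt (P.edge i k) (clamp (S - k))) (pt (P.edge i k) (clamp (T - k))) x := by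
    rw [eventually_all_finset]
    intro k hk
    rw [Finset.mem_range] at hk
    -- Degenerate pieces may be vertices off the loop or on it, but they contribute 0 everywhere.
    rcases (clamp_mono (sub_le_sub_right h.le (k : ℝ))).eq_or_lt with he | hl
    · refine Eventually.of_forall fun p => ?_
      rw [he]
      simp only [rayParityAt, rayParity_self, ZMod.two_add_self]
    · refine eventually_rayParityAt_eq fun hmem => hx ?_
      obtain ⟨t, ht, rfl⟩ := segment_pt_subset _ hl.le hmem
      exact pt_mem_curve_image hk hl ht
  filter_upwards [this] with p hp
  rw [h.loopParity_eq x, h.loopParity_eq x]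
  exact Finset.sum_congr rfl hp

/-- The mod 2 winding number changes across the loop. -/
theorem IsLoop.eventually_loopParity_add (h : IsLoop P i S T) {m : ℕ} (hm : m < P.size i) {t : ℝ}
    (ht : t ∈ Set.Ioo (0 : ℝ) 1) (hS : S < m + t) (hT : m + t < T)
    (hx : ∀ e, pt (P.edge i m) t ∈ seg e → e = P.edge i m) {v : ℂ}
    (hv : crossProd (dir (P.edge i m)) v ≠ 0) :
    ∀ᶠ b in 𝓝[>] (0 : ℝ), P.loopParity i S T (pt (P.edge i m) t + b • v) =
      P.loopParity i S T (pt (P.edge i m) t - b • v) + 1 := by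
  set x := pt (P.edge i m) t with hxdef
  have hsub : ∀ k, segment ℝ (pt (P.edge i k) (clamp (S - k))) (pt (P.edge i k) (clamp (T - k))) ⊆
      seg (P.edge i k) := fun k => (convex_segment _ _).segment_subset
        (pt_mem_seg _ (clamp_mem _)) (pt_mem_seg _ (clamp_mem _))
  -- Only edge `m` passes through `x`, so every other piece is locally constant there.
  have hother : ∀ᶠ p in 𝓝 x, ∀ k ∈ (Finset.range (P.size i)).erase m,
      rayParityAt x (pt (P.edge i k) (clamp (S - k))) (pt (P.edge i k) (clamp (T - k))) p =
      rayParityAt x (pt (P.edge i k) (clamp (S - k))) (pt (P.edge i k) (clamp (T - k))) x := by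
    rw [eventually_all_finset]
    intro k hk
    rw [Finset.mem_erase, Finset.mem_range] at hk
    exact eventually_rayParityAt_eq fun hmem =>
      hk.1 (edge_eq_edge hk.2 hm (hx _ (hsub k hmem)))
  have ha : clamp (S - m) < t := (clamp_lt_iff ht.1 ht.2.le).2 (by linarith)
  have hb : t < clamp (T - m) := (lt_clamp_iff ht.1.le ht.2).2 (by linarith)
  set a := clamp (S - m)
  set b := clamp (T - m)
  have hab : 0 < b - a := by linarith
  have hdir : pt (P.edge i m) b - pt (P.edge i m) a = (b - a) • dir (P.edge i m) := by
    rw [← sub_add_cancel b a, add_comm (b - a) a, pt_add]; simp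
  obtain ⟨c, hc⟩ := eventually_rayParityAt_add (x := x) (u := pt (P.edge i m) a)
    (v := pt (P.edge i m) b) (fun h => (ha.trans hb).ne (pt_injective _ h))
    -- The position of `x` within the clamped piece of edge `m`.
    (t := (t - a) / (b - a)) ⟨div_pos (by linarith) hab, (div_lt_one hab).2 (by linarith)⟩ (by
      rw [AffineMap.lineMap_apply_module', hdir, smul_smul, div_mul_cancel₀ _ hab.ne', add_comm,
        ← pt_add, hxdef]
      congr 1; ring)
  have key := hother.and hc
  have t1 : Tendsto (fun r : ℝ => x + r • v) (𝓝[>] 0) (𝓝 x) :=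
    tendsto_nhdsWithin_of_tendsto_nhds (Continuous.tendsto' (by fun_prop) _ _ (by simp))
  have t2 : Tendsto (fun r : ℝ => x - r • v) (𝓝[>] 0) (𝓝 x) :=
    tendsto_nhdsWithin_of_tendsto_nhds (Continuous.tendsto' (by fun_prop) _ _ (by simp))
  filter_upwards [t1.eventually key, t2.eventually key, self_mem_nhdsWithin] with r h1 h2 hr
  have hr : 0 < r := hr
  have e1 : crossProd (pt (P.edge i m) b - pt (P.edge i m) a) (x + r • v - x) =
      (b - a) * r * crossProd (dir (P.edge i m)) v := by
    rw [hdir]; simp [crossProd]; ring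
  have e2 : crossProd (pt (P.edge i m) b - pt (P.edge i m) a) (x - r • v - x) =
      -((b - a) * r * crossProd (dir (P.edge i m)) v) := by
    rw [hdir]; simp [crossProd]; ring
  have hne : (b - a) * r * crossProd (dir (P.edge i m)) v ≠ 0 := by positivity
  rw [h.loopParity_eq x, h.loopParity_eq x, ← Finset.add_sum_erase _ _ (Finset.mem_range.2 hm),
    ← Finset.add_sum_erase _ _ (Finset.mem_range.2 hm), Finset.sum_congr rfl h1.1,
    Finset.sum_congr rfl h2.1, h1.2 (by rwa [e1]), h2.2 (by rwa [e2, neg_ne_zero]), e1, e2]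
  rcases hne.lt_or_gt with hlt | hgt
  · rw [ind_false hlt.not_gt, ind_true (by linarith)]
    have : (2 : ZMod 2) = 0 := rfl
    linear_combination -this
  · rw [ind_true hgt, ind_false (by linarith)]
    ring

end LinkProjection

/-! ### Coordinates and corners at a crossing -/

theorem smul_add_smul_eq_zero {u v : ℂ} (h : crossProd u v ≠ 0) {a b : ℝ}
    (hab : a • u + b • v = 0) : a = 0 ∧ b = 0 := by
  have h1 : crossProd u (a • u + b • v) = b * crossProd u v := by
    simp [crossProd]; ring
  have h2 : crossProd v (a • u + b • v) = -(a * crossProd u v) := by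
    simp [crossProd]; ring
  rw [hab] at h1 h2
  have h0 : ∀ w : ℂ, crossProd w 0 = 0 := fun w => by simp [crossProd]
  rw [h0] at h1 h2
  simp only [zero_eq_mul, h, or_false, zero_eq_neg, mul_eq_zero] at h1 h2
  exact ⟨h2, h1⟩

/-- Near a point, the coordinates with respect to two independent vectors are small. -/
theorem eventually_exists_coordinates {u v : ℂ} (h : crossProd u v ≠ 0) (x : ℂ) {r : ℝ}
    (hr : 0 < r) : ∀ᶠ p in 𝓝 x, ∃ a b : ℝ, |a| < r ∧ |b| < r ∧ p = x + a • u + b • v := by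
  have h1 : ∀ᶠ p in 𝓝 x, |crossProd (p - x) v / crossProd u v| < r :=
    ContinuousAt.eventually_lt (f := fun p => |crossProd (p - x) v / crossProd u v|)
      (by fun_prop (disch := assumption)) continuousAt_const (by simp [crossProd, hr])
  have h2 : ∀ᶠ p in 𝓝 x, |crossProd u (p - x) / crossProd u v| < r :=
    ContinuousAt.eventually_lt (f := fun p => |crossProd u (p - x) / crossProd u v|)
      (by fun_prop (disch := assumption)) continuousAt_const (by simp [crossProd, hr])
  filter_upwards [h1, h2] with p h1 h2
  refine ⟨_, _, h1, h2, ?_⟩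
  -- Cramer's rule, with the denominator cleared.
  have e : crossProd u v • p = crossProd u v • x + crossProd (p - x) v • u +
      crossProd u (p - x) • v := by
    apply Complex.ext <;> simp [crossProd] <;> ring
  have h3 := congrArg (fun z => (crossProd u v)⁻¹ • z) e
  simp only [smul_add, inv_smul_smul₀ h] at h3
  rw [div_eq_inv_mul, div_eq_inv_mul, mul_smul, mul_smul]
  exact h3

/-- The function `F` is constant on the connected sets that do not meet `Z`. -/
def ConstOff {α : Type*} (F : ℂ → α) (Z : Set ℂ) : Prop :=
  ∀ A : Set ℂ, IsPreconnected A → Disjoint A Z → ∀ p ∈ A, ∀ q ∈ A, F p = F q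

theorem ConstOff.mono {α : Type*} {F : ℂ → α} {Z W : Set ℂ} (h : ConstOff F Z) (hZW : Z ⊆ W) :
    ConstOff F W := fun A hA hd => h A hA (hd.mono_right hZW)

theorem ConstOff.comp {α β : Type*} {F : ℂ → α} {Z : Set ℂ} (h : ConstOff F Z) (g : α → β) :
    ConstOff (fun p => g (F p)) Z := fun A hA hd p hp q hq => congrArg g (h A hA hd p hp q hq)

theorem constOff_of_eventually_eq {α : Type*} {F : ℂ → α} {Z : Set ℂ}
    (h : ∀ x ∉ Z, ∀ᶠ p in 𝓝 x, F p = F x) : ConstOff F Z := by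
  intro A hA hd p hp q hq
  -- With the discrete topology on the values, locally constant means continuous.
  let _ : TopologicalSpace α := ⊥
  have : DiscreteTopology α := ⟨rfl⟩
  refine hA.constant (f := F) (fun x hx => ?_) hp hq
  have := h x (Set.disjoint_left.1 hd hx)
  exact ((continuousAt_const (y := F x)).congr (this.mono fun _ h => h.symm)).continuousWithinAt

namespace LinkProjection

variable {n : ℕ} {P : LinkProjection n}

/-- The edges `e` and `f` cross at the point `x`, with parameters `s` and `t`; in the
coordinates along the edges, the other edges stay out of the square of half side `r`. -/
structure IsCrossing (x : ℂ) (e f : P.Edge) (s t r : ℝ) : Prop where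
  ne : e ≠ f
  pt_left : pt e s = x
  pt_right : pt f t = x
  indep : crossProd (dir e) (dir f) ≠ 0
  r_pos : 0 < r
  mem_left : ∀ a, |a| < r → s + a ∈ Set.Ioo (0 : ℝ) 1
  mem_right : ∀ a, |a| < r → t + a ∈ Set.Ioo (0 : ℝ) 1
  box : ∀ a b : ℝ, |a| < r → |b| < r → x + a • dir e + b • dir f ∈ P.polygons → a = 0 ∨ b = 0
  arm_left : ∀ a, a ≠ 0 → |a| < r → ∀ g, pt e (s + a) ∈ seg g → g = e
  arm_right : ∀ a, a ≠ 0 → |a| < r → ∀ g, pt f (t + a) ∈ seg g → g = f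

variable {x : ℂ} {e f : P.Edge} {s t r : ℝ}

theorem IsCrossing.symm (h : IsCrossing x e f s t r) : IsCrossing x f e t s r where
  ne := h.ne.symm
  pt_left := h.pt_right
  pt_right := h.pt_left
  indep := by rw [crossProd_comm, neg_ne_zero]; exact h.indep
  r_pos := h.r_pos
  mem_left := h.mem_right
  mem_right := h.mem_left
  box a b ha hb hab := (h.box b a hb ha (by rwa [add_right_comm])).symm
  arm_left := h.arm_right
  arm_right := h.arm_left

theorem exists_mem_Ioo {s : ℝ} (hs : s ∈ Set.Ioo (0 : ℝ) 1) :
    ∀ᶠ a in 𝓝 (0 : ℝ), s + a ∈ Set.Ioo (0 : ℝ) 1 := by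
  have : Tendsto (fun a : ℝ => s + a) (𝓝 0) (𝓝 s) := Continuous.tendsto' (by fun_prop) _ _ (by simp)
  exact this.eventually (isOpen_Ioo.mem_nhds hs)

/-- Near `x` only `e` and `f` occur, and by the independence of their directions they are the two
axes of an oblique coordinate system. The number `r` is a common radius for this and for staying in
the interior of both edges. -/
theorem exists_isCrossing (hx : NotVertex P x) (hef : e ≠ f) (he : x ∈ seg e) (hf : x ∈ seg f) :
    ∃ s t r, IsCrossing x e f s t r := by
  obtain ⟨s, hs, rfl⟩ := hx.exists_pt he
  obtain ⟨t, ht, htx⟩ := hx.exists_pt hf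
  have hind := crossProd_dir_ne_zero hef hs ht htx.symm
  have htend : Tendsto (fun ab : ℝ × ℝ => pt e s + ab.1 • dir e + ab.2 • dir f) (𝓝 (0, 0))
      (𝓝 (pt e s)) := Continuous.tendsto' (by fun_prop) _ _ (by simp)
  have h1 := htend.eventually (eventually_mem_seg (P := P) (pt e s))
  have h2 := (continuous_fst.tendsto ((0 : ℝ), (0 : ℝ))).eventually (exists_mem_Ioo hs)
  have h3 := (continuous_fst.tendsto ((0 : ℝ), (0 : ℝ))).eventually (exists_mem_Ioo ht)
  obtain ⟨r, hr, hball⟩ := Metric.eventually_nhds_iff.1 (h1.and (h2.and h3))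
  have hd : ∀ a b : ℝ, |a| < r → |b| < r → dist (a, b) ((0 : ℝ), (0 : ℝ)) < r := by
    intro a b ha hb
    rw [Prod.dist_eq]; simp [ha, hb]
  have hon : ∀ a b : ℝ, |a| < r → |b| < r → ∀ g, pt e s + a • dir e + b • dir f ∈ seg g →
      (g = e ∧ b = 0) ∨ (g = f ∧ a = 0) := by
    intro a b ha hb g hg
    rcases eq_or_eq_of_mem_seg hef he hf ((hball (hd a b ha hb)).1 g hg) with rfl | rfl
    · obtain ⟨u, -, hu⟩ := mem_seg_iff.1 hg
      have : (a - (u - s)) • dir g + b • dir f = 0 := by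
        have e1 : pt g u = pt g s + (u - s) • dir g := by rw [← pt_add]; congr 1; ring
        rw [e1] at hu
        rw [sub_smul]
        linear_combination -hu
      exact Or.inl ⟨rfl, (smul_add_smul_eq_zero hind this).2⟩
    · obtain ⟨u, -, hu⟩ := mem_seg_iff.1 hg
      have : a • dir e + (b - (u - t)) • dir g = 0 := by
        have e1 : pt g u = pt g t + (u - t) • dir g := by rw [← pt_add]; congr 1; ring
        rw [e1, htx] at hu
        rw [sub_smul]
        linear_combination -hu
      exact Or.inr ⟨rfl, (smul_add_smul_eq_zero hind this).1⟩
  refine ⟨s, t, r, hef, rfl, htx, hind, hr, fun a ha => (hball (hd a 0 ha (by simpa))).2.1,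
    fun a ha => (hball (hd a 0 ha (by simpa))).2.2, fun a b ha hb hab => ?_,
    fun a ha0 ha g hg => ?_, fun a ha0 ha g hg => ?_⟩
  · obtain ⟨g, hg⟩ := Set.mem_iUnion.1 hab
    rcases hon a b ha hb g hg with h | h
    · exact Or.inr h.2
    · exact Or.inl h.2
  · rcases hon a 0 ha (by simpa) g (by simpa [pt_add] using hg) with h | h
    · exact h.1
    · exact absurd h.2 ha0
  · rcases hon 0 a (by simpa) ha g (by simpa [pt_add, htx] using hg) with h | h
    · exact absurd h.2 ha0
    · exact h.1

/-- A sign. -/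
def sg (α : Bool) : ℝ := if α then 1 else -1

@[simp] theorem sg_true : sg true = 1 := rfl

@[simp] theorem sg_false : sg false = -1 := rfl

theorem abs_sg_mul (α : Bool) (a : ℝ) : |sg α * a| = |a| := by cases α <;> simp

theorem sg_ne_zero (α : Bool) : sg α ≠ 0 := by cases α <;> simp

/-- A point in one of the four corners at a crossing. -/
noncomputable def corner (x : ℂ) (e f : P.Edge) (r : ℝ) (α β : Bool) : ℂ :=
  x + (sg α * (r / 2)) • dir e + (sg β * (r / 2)) • dir f

theorem corner_symm (x : ℂ) (e f : P.Edge) (r : ℝ) (α β : Bool) :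
    corner x f e r β α = corner x e f r α β := add_right_comm _ _ _

/-- An open quadrant of the coordinate box is connected and misses the polygons, so `corner` may
stand for any of its points. -/
theorem IsCrossing.quadrant {α : Type*} {F : ℂ → α} (h : IsCrossing x e f s t r)
    (hF : ConstOff F P.polygons) (σ τ : Bool) {a b : ℝ} (ha : a ∈ Set.Ioo 0 r)
    (hb : b ∈ Set.Ioo 0 r) :
    F (x + (sg σ * a) • dir e + (sg τ * b) • dir f) = F (corner x e f r σ τ) := by
  have hr := h.r_pos
  refine hF ((fun ab : ℝ × ℝ => x + (sg σ * ab.1) • dir e + (sg τ * ab.2) • dir f) ''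
    (Set.Ioo 0 r ×ˢ Set.Ioo 0 r))
    ((((convex_Ioo _ _).prod (convex_Ioo _ _)).isPreconnected).image _ (by fun_prop)) ?_ _
    ⟨(a, b), ⟨ha, hb⟩, rfl⟩ _ ⟨(r / 2, r / 2), ⟨⟨?_, ?_⟩, ?_, ?_⟩, rfl⟩
  · rw [Set.disjoint_left]
    rintro _ ⟨⟨a, b⟩, ⟨ha, hb⟩, rfl⟩ hmem
    simp only [Set.mem_Ioo] at ha hb
    have := h.box (sg σ * a) (sg τ * b) (by rw [abs_sg_mul, abs_of_pos ha.1]; exact ha.2)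
      (by rw [abs_sg_mul, abs_of_pos hb.1]; exact hb.2) hmem
    simp [sg_ne_zero, ha.1.ne', hb.1.ne'] at this
  all_goals simp only; linarith

theorem corner_notMem (h : IsCrossing x e f s t r) (σ τ : Bool) :
    corner x e f r σ τ ∉ P.polygons := by
  intro hmem
  have hr := h.r_pos
  have hh : |r / 2| < r := by rw [abs_of_pos (by linarith)]; linarith
  have := h.box (sg σ * (r / 2)) (sg τ * (r / 2)) (by rwa [abs_sg_mul]) (by rwa [abs_sg_mul]) hmem
  simp [sg_ne_zero, hr.ne'] at this

theorem tendsto_add_smul (x v : ℂ) (c : ℝ) :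
    Tendsto (fun b : ℝ => x + (c * b) • v) (𝓝[>] 0) (𝓝 x) :=
  tendsto_nhdsWithin_of_tendsto_nhds (Continuous.tendsto' (by fun_prop) _ _ (by simp))

/-- A function that is locally constant at a point of an arm of the crossing takes the same value
in the adjacent corners. -/
theorem IsCrossing.corner_eq {α : Type*} {F : ℂ → α} (h : IsCrossing x e f s t r)
    (hF : ConstOff F P.polygons) (σ τ : Bool) {a : ℝ} (ha : a ∈ Set.Ioo 0 r)
    (hev : ∀ᶠ p in 𝓝 (pt e (s + sg σ * a)), F p = F (pt e (s + sg σ * a))) :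
    F (corner x e f r σ τ) = F (pt e (s + sg σ * a)) := by
  obtain ⟨b, hb, hb'⟩ := (((tendsto_add_smul _ (dir f) (sg τ)).eventually hev).and
    (Ioo_mem_nhdsGT h.r_pos)).exists
  rw [← hb, pt_add, h.pt_left, h.quadrant hF σ τ ha hb']

theorem IsCrossing.corner_flip {F : ℂ → ZMod 2} (h : IsCrossing x e f s t r)
    (hF : ConstOff F P.polygons) (σ : Bool) {a : ℝ} (ha : a ∈ Set.Ioo 0 r)
    (hev : ∀ᶠ b in 𝓝[>] (0 : ℝ), F (pt e (s + sg σ * a) + b • dir f) =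
      F (pt e (s + sg σ * a) - b • dir f) + 1) :
    F (corner x e f r σ true) = F (corner x e f r σ false) + 1 := by
  obtain ⟨b, hb, hb'⟩ := (hev.and (Ioo_mem_nhdsGT h.r_pos)).exists
  rw [← h.quadrant hF σ true ha hb', ← h.quadrant hF σ false ha hb', ← h.pt_left, ← pt_add]
  simpa [sub_eq_add_neg] using hb

variable {i : Fin n} {S T : ℝ}

/-- A point that lies on one edge only is passed at one time only. This turns membership in a loop
into a comparison of times. -/
theorem eq_of_curve_eq {u U : ℝ} (hU : U ∈ Set.Icc (0 : ℝ) (P.size i)) (h : P.curve i U = pt e u)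
    (he : ∀ g, pt e u ∈ seg g → g = e) : e.1 = i ∧ U = idx e + u := by
  obtain ⟨m, hm, v, hv, rfl⟩ := exists_eq_add (size_pos i) hU
  rw [curve_add i hm hv] at h
  have h1 := he (P.edge i m) (h ▸ pt_mem_seg _ hv)
  subst h1
  rw [pt_injective _ h]
  refine ⟨rfl, ?_⟩
  congr 2
  exact edge_eq_edge hm (idx_lt (P.edge i m)) (edge_idx (P.edge i m)).symm

theorem curve_subset (hS : 0 ≤ S) (hT : T ≤ P.size i) :
    P.curve i '' Set.Icc S T ⊆ P.polygons := by
  rintro _ ⟨U, hU, rfl⟩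
  obtain ⟨m, hm, v, hv, rfl⟩ := exists_eq_add (size_pos i)
    ⟨hS.trans hU.1, hU.2.trans hT⟩
  rw [curve_add i hm hv]
  exact seg_subset_polygons _ (pt_mem_seg _ hv)

theorem IsLoop.constOff (h : IsLoop P i S T) : ConstOff (P.loopParity i S T) P.polygons :=
  (constOff_of_eventually_eq fun _ hx => h.eventually_loopParity_eq hx).mono
    (curve_subset h.nonneg h.le_size)

theorem IsCrossing.abs_sg_lt (_h : IsCrossing x e f s t r) (σ : Bool) {a : ℝ}
    (ha : a ∈ Set.Ioo 0 r) : |sg σ * a| < r := by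
  rw [abs_sg_mul, abs_of_pos ha.1]; exact ha.2

theorem IsLoop.corner_flip (hl : IsLoop P i S T) (h : IsCrossing x e f s t r) (hi : e.1 = i)
    (σ : Bool) {a : ℝ} (ha : a ∈ Set.Ioo 0 r) (h1 : S < idx e + (s + sg σ * a))
    (h2 : idx e + (s + sg σ * a) < T) :
    P.loopParity i S T (corner x e f r σ true) = P.loopParity i S T (corner x e f r σ false) + 1 := by
  subst hi
  refine h.corner_flip hl.constOff σ ha ?_
  have := hl.eventually_loopParity_add (idx_lt e) (h.mem_left _ (h.abs_sg_lt σ ha)) h1 h2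
    (v := dir f)
  rw [edge_idx] at this
  exact this (h.arm_left _ (mul_ne_zero (sg_ne_zero σ) ha.1.ne') (h.abs_sg_lt σ ha)) h.indep

theorem IsLoop.corner_eq (hl : IsLoop P i S T) (h : IsCrossing x e f s t r) (σ τ : Bool) {a : ℝ}
    (ha : a ∈ Set.Ioo 0 r)
    (h1 : e.1 = i → idx e + (s + sg σ * a) < S ∨ T < idx e + (s + sg σ * a)) :
    P.loopParity i S T (corner x e f r σ τ) = P.loopParity i S T (pt e (s + sg σ * a)) := by
  refine h.corner_eq hl.constOff σ τ ha (hl.eventually_loopParity_eq ?_)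
  rintro ⟨U, hU, hUe⟩
  obtain ⟨h2, h3⟩ := eq_of_curve_eq ⟨hl.nonneg.trans hU.1, hU.2.trans hl.le_size⟩ hUe
    (h.arm_left _ (mul_ne_zero (sg_ne_zero σ) ha.1.ne') (h.abs_sg_lt σ ha))
  rcases h1 h2 with h | h
  · linarith [hU.1]
  · linarith [hU.2]

/-- Here and in the next three lemmas only one arm of `e` matters, the forward one for `true` and
the backward one for `false`. Hence one inequality is strict and the other is not, and loops that
start or end at the crossing are covered. -/
theorem IsLoop.flip_true (hl : IsLoop P i S T) (h : IsCrossing x e f s t r) (hi : e.1 = i)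
    (h1 : S ≤ idx e + s) (h2 : idx e + s < T) : P.loopParity i S T (corner x e f r true true) =
      P.loopParity i S T (corner x e f r true false) + 1 := by
  obtain ⟨a, ha, ha', hr⟩ : ∃ a : ℝ, 0 < a ∧ a < T - (idx e + s) ∧ a < r := by
    obtain ⟨a, ha⟩ := exists_between (lt_min (sub_pos.2 h2) h.r_pos)
    exact ⟨a, ha.1, ha.2.trans_le (min_le_left _ _), ha.2.trans_le (min_le_right _ _)⟩
  exact hl.corner_flip h hi true ⟨ha, hr⟩ (by simp only [sg_true]; linarith)
    (by simp only [sg_true]; linarith)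

theorem IsLoop.flip_false (hl : IsLoop P i S T) (h : IsCrossing x e f s t r) (hi : e.1 = i)
    (h1 : S < idx e + s) (h2 : idx e + s ≤ T) : P.loopParity i S T (corner x e f r false true) =
      P.loopParity i S T (corner x e f r false false) + 1 := by
  obtain ⟨a, ha, ha', hr⟩ : ∃ a : ℝ, 0 < a ∧ a < (idx e + s) - S ∧ a < r := by
    obtain ⟨a, ha⟩ := exists_between (lt_min (sub_pos.2 h1) h.r_pos)
    exact ⟨a, ha.1, ha.2.trans_le (min_le_left _ _), ha.2.trans_le (min_le_right _ _)⟩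
  exact hl.corner_flip h hi false ⟨ha, hr⟩ (by simp only [sg_false]; linarith)
    (by simp only [sg_false]; linarith)

theorem IsLoop.eq_true (hl : IsLoop P i S T) (h : IsCrossing x e f s t r)
    (h1 : e.1 = i → idx e + s < S ∨ T ≤ idx e + s) : P.loopParity i S T (corner x e f r true true) =
      P.loopParity i S T (corner x e f r true false) := by
  obtain ⟨a, ha, hr, ha'⟩ : ∃ a : ℝ, 0 < a ∧ a < r ∧ (idx e + s < S → idx e + s + a < S) := by
    by_cases h2 : idx e + s < S
    · obtain ⟨a, ha⟩ := exists_between (lt_min (sub_pos.2 h2) h.r_pos)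
      exact ⟨a, ha.1, ha.2.trans_le (min_le_right _ _), fun _ => by
        linarith [ha.2.trans_le (min_le_left _ _)]⟩
    · exact ⟨r / 2, by linarith [h.r_pos], by linarith [h.r_pos], fun h => absurd h h2⟩
  have h2 : e.1 = i → idx e + (s + sg true * a) < S ∨ T < idx e + (s + sg true * a) := by
    intro hi
    simp only [sg_true]
    rcases h1 hi with h | h
    · exact Or.inl (by linarith [ha' h])
    · exact Or.inr (by linarith)
  rw [hl.corner_eq h true true ⟨ha, hr⟩ h2, hl.corner_eq h true false ⟨ha, hr⟩ h2]

theorem IsLoop.eq_false (hl : IsLoop P i S T) (h : IsCrossing x e f s t r)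
    (h1 : e.1 = i → idx e + s ≤ S ∨ T < idx e + s) : P.loopParity i S T (corner x e f r false true) =
      P.loopParity i S T (corner x e f r false false) := by
  obtain ⟨a, ha, hr, ha'⟩ : ∃ a : ℝ, 0 < a ∧ a < r ∧ (T < idx e + s → T < idx e + s - a) := by
    by_cases h2 : T < idx e + s
    · obtain ⟨a, ha⟩ := exists_between (lt_min (sub_pos.2 h2) h.r_pos)
      exact ⟨a, ha.1, ha.2.trans_le (min_le_right _ _), fun _ => by
        linarith [ha.2.trans_le (min_le_left _ _)]⟩
    · exact ⟨r / 2, by linarith [h.r_pos], by linarith [h.r_pos], fun h => absurd h h2⟩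
  have h2 : e.1 = i → idx e + (s + sg false * a) < S ∨ T < idx e + (s + sg false * a) := by
    intro hi
    simp only [sg_false]
    rcases h1 hi with h | h
    · exact Or.inl (by linarith)
    · exact Or.inr (by linarith [ha' h])
  rw [hl.corner_eq h false true ⟨ha, hr⟩ h2, hl.corner_eq h false false ⟨ha, hr⟩ h2]

end LinkProjection

/-! ### Regions, incidence and corners -/

namespace LinkProjection

variable {n : ℕ} {P : LinkProjection n}

variable (P) in
/-- The region that contains the image of a point of the plane of the polygons. -/
def reg (p : ℂ) : Set ℂ := connectedComponentIn P.carrierᶜ (P.ambient p)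

theorem ambient_mem_arc {x : ℂ} {e : P.Edge} : P.ambient x ∈ P.arc e ↔ x ∈ seg e :=
  P.ambient.injective.mem_set_image

theorem ambient_mem_component {x : ℂ} {i : Fin n} :
    P.ambient x ∈ P.component i ↔ ∃ e : P.Edge, e.1 = i ∧ x ∈ seg e := by
  simp only [component, Set.mem_iUnion, ambient_mem_arc]
  constructor
  · rintro ⟨k, hk⟩; exact ⟨_, rfl, hk⟩
  · rintro ⟨⟨j, k⟩, rfl, hk⟩; exact ⟨k, hk⟩

theorem ambient_mem_carrier {x : ℂ} : P.ambient x ∈ P.carrier ↔ x ∈ P.polygons := by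
  simp only [carrier, polygons, Set.mem_iUnion, ambient_mem_component]
  exact ⟨fun ⟨_, e, _, he⟩ => ⟨e, he⟩, fun ⟨e, he⟩ => ⟨_, e, rfl, he⟩⟩

theorem constOff_reg : ConstOff (reg P) P.polygons := by
  intro A hA hd p hp q hq
  refine connectedComponentIn_eq ?_
  refine (hA.image _ P.ambient.continuous.continuousOn).subset_connectedComponentIn
    ⟨p, hp, rfl⟩ ?_ ⟨q, hq, rfl⟩
  rintro _ ⟨z, hz, rfl⟩ hmem
  exact Set.disjoint_left.1 hd hz (ambient_mem_carrier.1 hmem)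

theorem mem_reg {p : ℂ} (hp : p ∉ P.polygons) : P.ambient p ∈ reg P p :=
  mem_connectedComponentIn fun h => hp (ambient_mem_carrier.1 h)

/-- Pulled back by `ambient`, a region is a connected set that misses the polygons. -/
theorem eq_of_reg_eq {α : Type*} {F : ℂ → α} (hF : ConstOff F P.polygons) {p q : ℂ}
    (hp : p ∉ P.polygons) (hq : q ∉ P.polygons) (h : reg P p = reg P q) : F p = F q := by
  refine hF (P.ambient.symm '' reg P p)
    (isPreconnected_connectedComponentIn.image _ P.ambient.symm.continuous.continuousOn) ?_ _
    ⟨_, mem_reg hp, by simp⟩ _ ⟨_, h ▸ mem_reg hq, by simp⟩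
  rw [Set.disjoint_left]
  rintro _ ⟨z, hz, rfl⟩ hmem
  rw [← ambient_mem_carrier, Homeomorph.apply_symm_apply] at hmem
  exact connectedComponentIn_subset _ _ hz hmem

/-- A function that is constant on the regions induces a function of the regions. -/
theorem exists_region_function {F : ℂ → ZMod 2} (hF : ConstOff F P.polygons) :
    ∃ X : Set ℂ → ZMod 2, ∀ p ∉ P.polygons, X (reg P p) = F p := by
  -- The value is 1 on the regions where `F` is 1, and 0 on all other sets, whether regions or not.
  refine ⟨fun R => ind (∃ p ∉ P.polygons, reg P p = R ∧ F p = 1), fun p hp => ?_⟩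
  beta_reduce
  rcases ZMod.two_eq_zero_or_one (F p) with h | h
  · rw [h, ind_false]
    rintro ⟨q, hq, hqp, h1⟩
    rw [eq_of_reg_eq hF hq hp hqp, h] at h1
    exact absurd h1 (by decide)
  · rw [h, ind_true ⟨p, hp, rfl, h⟩]

theorem isRegion_reg {p : ℂ} (hp : p ∉ P.polygons) : P.IsRegion (reg P p) :=
  ⟨P.ambient p, fun h => hp (ambient_mem_carrier.1 h), rfl⟩

variable (P) in
/-- The two edges through a crossing point, with the crossing parameters. -/
structure Strands (x : ℂ) where
  /-- the first edge -/
  e : P.Edge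
  /-- the second edge -/
  f : P.Edge
  /-- the parameter on the first edge -/
  s : ℝ
  /-- the parameter on the second edge -/
  t : ℝ
  /-- the size of the four corners -/
  r : ℝ
  isCrossing : IsCrossing x e f s t r
  idx_lt : e.1 = f.1 → idx e < idx f

/-- The point of the polygons that corresponds to a crossing point. -/
noncomputable def pos (c : P.crossings) : ℂ := P.ambient.symm c

theorem ambient_pos (c : P.crossings) : P.ambient (pos c) = c := by simp [pos]

theorem notVertex_pos (c : P.crossings) : NotVertex P (pos c) := fun e he =>
  c.2.1 e.1 e.2 (by rw [← ambient_pos c, he]; rfl)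

/-- Distinct edges of one component have distinct `idx`, so at a self-crossing the strands can be
put in the order of passage. The loop between the two passages then has increasing times. -/
theorem exists_strands (c : P.crossings) : Nonempty (Strands P (pos c)) := by
  obtain ⟨e, f, hef, he, hf⟩ := c.2.2
  rw [← ambient_pos c, ambient_mem_arc] at he hf
  obtain ⟨s, t, r, h⟩ := exists_isCrossing (notVertex_pos c) hef he hf
  by_cases hlt : idx e < idx f
  · exact ⟨⟨e, f, s, t, r, h, fun _ => hlt⟩⟩
  · refine ⟨⟨f, e, t, s, r, h.symm, fun h1 => lt_of_le_of_ne (not_lt.1 hlt) fun h2 => hef ?_⟩⟩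
    rw [← edge_idx e, ← edge_idx f, h1, h2]

/-- A choice of strands at each crossing point. -/
noncomputable def strands (c : P.crossings) : Strands P (pos c) := (exists_strands c).some

theorem IsCrossing.pt_add {x : ℂ} {e f : P.Edge} {s t r : ℝ} (h : IsCrossing x e f s t r) (a : ℝ) :
    pt e (s + a) = x + a • dir e := by
  rw [LinkProjection.pt_add, h.pt_left]

theorem IsCrossing.mem_left_seg {x : ℂ} {e f : P.Edge} {s t r : ℝ} (h : IsCrossing x e f s t r) :
    x ∈ seg e := by
  have := h.mem_left 0 (by simpa using h.r_pos)
  rw [add_zero] at this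
  exact h.pt_left ▸ pt_mem_seg e ⟨this.1.le, this.2.le⟩

theorem IsCrossing.mem_Ioo {x : ℂ} {e f : P.Edge} {s t r : ℝ} (h : IsCrossing x e f s t r) :
    s ∈ Set.Ioo (0 : ℝ) 1 := by
  simpa using h.mem_left 0 (by simpa using h.r_pos)

theorem Strands.mem_seg_iff {x : ℂ} (σ : Strands P x) {g : P.Edge} :
    x ∈ seg g ↔ g = σ.e ∨ g = σ.f := by
  have h1 := σ.isCrossing.mem_left_seg
  have h2 := σ.isCrossing.symm.mem_left_seg
  refine ⟨fun h => eq_or_eq_of_mem_seg σ.isCrossing.ne h1 h2 h, ?_⟩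
  rintro (rfl | rfl) <;> assumption

theorem pos_injective : Function.Injective (pos : P.crossings → ℂ) := fun c d h => by
  apply Subtype.ext; rw [← ambient_pos c, ← ambient_pos d, h]

theorem Strands.eq_of_mem {x y : ℂ} (σ : Strands P x) (h1 : y ∈ seg σ.e) (h2 : y ∈ seg σ.f) :
    y = x := by
  obtain ⟨u, -, hu⟩ := LinkProjection.mem_seg_iff.1 h1
  obtain ⟨v, -, hv⟩ := LinkProjection.mem_seg_iff.1 h2
  have e1 : y = x + (u - σ.s) • dir σ.e := by
    rw [← σ.isCrossing.pt_add, ← hu]; congr 1; ring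
  have e2 : y = x + (v - σ.t) • dir σ.f := by
    rw [← σ.isCrossing.symm.pt_add, ← hv]; congr 1; ring
  have := smul_add_smul_eq_zero σ.isCrossing.indep (a := u - σ.s) (b := -(v - σ.t)) (by
    rw [neg_smul]; linear_combination e2 - e1)
  rw [e1, this.1]; simp

/-- Two edges with independent directions meet in at most one point, so the pair of strands
determines the crossing point. -/
instance : Finite P.crossings := by
  refine Finite.of_injective (fun c : P.crossings => ((strands c).e, (strands c).f)) ?_
  intro c d h
  simp only [Prod.mk.injEq] at h
  refine pos_injective ((strands d).eq_of_mem ?_ ?_)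
  · exact h.1 ▸ (strands c).isCrossing.mem_left_seg
  · exact h.2 ▸ (strands c).isCrossing.symm.mem_left_seg

noncomputable instance : Fintype P.crossings := Fintype.ofFinite _

/-- The corner point of a crossing point. -/
noncomputable def cornerPt (c : P.crossings) (p : Bool × Bool) : ℂ :=
  corner (pos c) (strands c).e (strands c).f (strands c).r p.1 p.2

theorem cornerPt_notMem (c : P.crossings) (p : Bool × Bool) : cornerPt c p ∉ P.polygons :=
  corner_notMem (strands c).isCrossing _ _

theorem exists_sg_mul {a r : ℝ} (ha : a ≠ 0) (h : |a| < r) :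
    ∃ σ, ∃ b ∈ Set.Ioo 0 r, a = sg σ * b := by
  rcases ha.lt_or_gt with h0 | h0
  · exact ⟨false, -a, ⟨by linarith, by rwa [abs_of_neg h0] at h⟩, by simp⟩
  · exact ⟨true, a, ⟨h0, by rwa [abs_of_pos h0] at h⟩, by simp⟩

/-- The regions incident to a crossing point are those at its four corners. -/
theorem mem_closure_iff_corner (c : P.crossings) {R : Set ℂ} (hR : P.IsRegion R) :
    (c : ℂ) ∈ closure R ↔ ∃ p, reg P (cornerPt c p) = R := by
  have hc := (strands c).isCrossing
  constructor
  · intro hcl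
    obtain ⟨y, hy, rfl⟩ := hR
    have hev := eventually_exists_coordinates hc.indep (pos c) hc.r_pos
    have hev' : ∀ᶠ z in 𝓝 (c : ℂ), ∃ a b : ℝ, |a| < (strands c).r ∧ |b| < (strands c).r ∧
        P.ambient.symm z = pos c + a • dir (strands c).e + b • dir (strands c).f :=
      (P.ambient.symm.continuous.tendsto (c : ℂ)).eventually hev
    obtain ⟨z, ⟨a, b, ha, hb, hz⟩, hzR⟩ := mem_closure_iff_nhds.1 hcl _ hev'
    have hzc : P.ambient.symm z ∉ P.polygons := by
      rw [← ambient_mem_carrier, Homeomorph.apply_symm_apply]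
      exact connectedComponentIn_subset _ _ hzR
    -- A nearby point of the region is off both axes, since the axes belong to the polygons; so it
    -- lies in an open quadrant.
    have ha0 : a ≠ 0 := by
      rintro rfl
      refine hzc (seg_subset_polygons (strands c).f ?_)
      rw [hz, zero_smul, add_zero, ← hc.symm.pt_add]
      exact pt_mem_seg _ (Set.Ioo_subset_Icc_self (hc.mem_right b hb))
    have hb0 : b ≠ 0 := by
      rintro rfl
      refine hzc (seg_subset_polygons (strands c).e ?_)
      rw [hz, zero_smul, add_zero, ← hc.pt_add]
      exact pt_mem_seg _ (Set.Ioo_subset_Icc_self (hc.mem_left a ha))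
    obtain ⟨σ, a', ha', rfl⟩ := exists_sg_mul ha0 ha
    obtain ⟨τ, b', hb', rfl⟩ := exists_sg_mul hb0 hb
    refine ⟨(σ, τ), ?_⟩
    rw [cornerPt, ← hc.quadrant constOff_reg σ τ ha' hb', ← hz, reg,
      Homeomorph.apply_symm_apply]
    exact (connectedComponentIn_eq hzR).symm
  · rintro ⟨⟨σ, τ⟩, rfl⟩
    have htend : Tendsto (fun b : ℝ => P.ambient (pos c + (sg σ * b) • dir (strands c).e +
        (sg τ * b) • dir (strands c).f)) (𝓝[>] 0) (𝓝 (c : ℂ)) :=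
      tendsto_nhdsWithin_of_tendsto_nhds (Continuous.tendsto' (by fun_prop) _ _
        (by simp [ambient_pos]))
    refine mem_closure_of_tendsto htend ?_
    filter_upwards [Ioo_mem_nhdsGT hc.r_pos] with b hb
    rw [cornerPt, ← hc.quadrant constOff_reg σ τ hb hb]
    refine mem_reg fun hmem => ?_
    have := hc.box _ _ (hc.abs_sg_lt σ hb) (hc.abs_sg_lt τ hb) hmem
    simp [sg_ne_zero, hb.1.ne'] at this

open Classical in
/-- The regions at the corners of a crossing point. -/
noncomputable def cornerRegions (c : P.crossings) : Finset (Set ℂ) :=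
  Finset.univ.image fun p => reg P (cornerPt c p)

theorem mem_cornerRegions_iff (c : P.crossings) {R : Set ℂ} (hR : P.IsRegion R) :
    R ∈ cornerRegions c ↔ c ∈ P.incident R := by
  rw [incident, Set.mem_ofPred_eq, mem_closure_iff_corner c hR, cornerRegions]
  simp

theorem sum_bool_prod {M : Type*} [AddCommMonoid M] (g : Bool × Bool → M) : ∑ p, g p =
    g (true, true) + g (true, false) + (g (false, true) + g (false, false)) := by
  rw [Fintype.sum_prod_type]; simp

theorem sum_cornerRegions_of_injective (c : P.crossings)
    (h : Function.Injective fun p => reg P (cornerPt c p)) (X : Set ℂ → ZMod 2) :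
    ∑ R ∈ cornerRegions c, X R = ∑ p, X (reg P (cornerPt c p)) := by
  rw [cornerRegions, Finset.sum_image h.injOn]

theorem injective_bool_prod {α : Type*} {g : Bool × Bool → α}
    (h1 : ∀ σ, g (σ, true) ≠ g (σ, false)) (h2 : ∀ τ, g (true, τ) ≠ g (false, τ))
    (h3 : g (true, true) ≠ g (false, false)) (h4 : g (true, false) ≠ g (false, true)) :
    Function.Injective g := by
  have a1 := h1 true
  have a2 := h1 false
  have a3 := h2 true
  have a4 := h2 false
  rintro ⟨_ | _, _ | _⟩ ⟨_ | _, _ | _⟩ h <;> first | rfl | exact absurd h (by tauto)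

/-- The strand times of a crossing point. -/
noncomputable def fstTime (c : P.crossings) : ℝ := idx (strands c).e + (strands c).s

/-- The strand times of a crossing point. -/
noncomputable def sndTime (c : P.crossings) : ℝ := idx (strands c).f + (strands c).t

theorem time_mem {x : ℂ} {e f : P.Edge} {s t r : ℝ} (h : IsCrossing x e f s t r) :
    idx e + s ∈ Set.Ioo (0 : ℝ) (P.size e.1) := by
  have h1 : (idx e : ℝ) + 1 ≤ P.size e.1 := by exact_mod_cast idx_lt e
  have h0 : (0 : ℝ) ≤ idx e := Nat.cast_nonneg _
  have := h.mem_Ioo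
  exact ⟨by linarith [this.1], by linarith [this.2]⟩

theorem curve_time {x : ℂ} {e f : P.Edge} {s t r : ℝ} (h : IsCrossing x e f s t r) :
    P.curve e.1 (idx e + s) = x := by
  rw [curve_add _ (idx_lt e) (Set.Ioo_subset_Icc_self h.mem_Ioo), edge_idx, h.pt_left]

/-- The corners that are adjacent along an edge lie in different regions. -/
theorem reg_corner_ne {x : ℂ} {e f : P.Edge} {s t r : ℝ} (h : IsCrossing x e f s t r) (σ : Bool) :
    reg P (corner x e f r σ true) ≠ reg P (corner x e f r σ false) := by
  intro heq
  -- The winding number of the whole component through `e` changes across `e`.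
  have h1 := eq_of_reg_eq (isLoop_size (P := P) e.1).constOff (corner_notMem h _ _)
    (corner_notMem h _ _) heq
  have h2 := time_mem h
  cases σ
  · rw [(isLoop_size e.1).flip_false h rfl h2.1 h2.2.le] at h1
    simp at h1
  · rw [(isLoop_size e.1).flip_true h rfl h2.1.le h2.2] at h1
    simp at h1

theorem reg_cornerPt_ne_snd (c : P.crossings) (σ : Bool) :
    reg P (cornerPt c (σ, true)) ≠ reg P (cornerPt c (σ, false)) :=
  reg_corner_ne (strands c).isCrossing σ

theorem reg_cornerPt_ne_fst (c : P.crossings) (τ : Bool) :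
    reg P (cornerPt c (true, τ)) ≠ reg P (cornerPt c (false, τ)) := by
  have := reg_corner_ne (strands c).isCrossing.symm τ
  rwa [corner_symm _ _ _ _ true τ, corner_symm _ _ _ _ false τ] at this

/-- At a crossing point of two components, the four corners lie in different regions. -/
theorem injective_reg_cornerPt (c : P.crossings) (hc : (strands c).e.1 ≠ (strands c).f.1) :
    Function.Injective fun p => reg P (cornerPt c p) := by
  have h := (strands c).isCrossing
  have hl := isLoop_size (P := P) (strands c).e.1
  have h2 := time_mem h
  -- The winding number of the component through `e` changes across `e` but not across `f`, so it
  -- separates opposite corners.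
  have e1 := hl.flip_true h rfl h2.1.le h2.2
  have e2 := hl.flip_false h rfl h2.1 h2.2.le
  have e3 := hl.eq_true h.symm fun h => absurd h.symm hc
  have e4 := hl.eq_false h.symm fun h => absurd h.symm hc
  rw [corner_symm _ _ _ _ true true, corner_symm _ _ _ _ false true] at e3
  rw [corner_symm _ _ _ _ true false, corner_symm _ _ _ _ false false] at e4
  refine injective_bool_prod (reg_cornerPt_ne_snd c) (reg_cornerPt_ne_fst c) ?_ ?_
  · intro heq
    have h1 := eq_of_reg_eq hl.constOff (cornerPt_notMem c _) (cornerPt_notMem c _) heq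
    simp only [cornerPt] at h1
    rw [e1, ← e4] at h1
    simp at h1
  · intro heq
    have h1 := eq_of_reg_eq hl.constOff (cornerPt_notMem c _) (cornerPt_notMem c _) heq
    simp only [cornerPt] at h1
    rw [e2, ← e4] at h1
    simp at h1

/-! ### Self-crossings and reducible crossing points -/

/-- At a self-crossing point, two opposite corners may lie in the same region. -/
def IsReducible (c : P.crossings) : Prop :=
  reg P (cornerPt c (true, true)) = reg P (cornerPt c (false, false))

variable {c : P.crossings}

theorem isLoop_times (hc : (strands c).e.1 = (strands c).f.1) :
    IsLoop P (strands c).e.1 (fstTime c) (sndTime c) := by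
  have h := (strands c).isCrossing
  have h1 := time_mem h
  have h2 := time_mem h.symm
  have h3 : (idx (strands c).e : ℝ) + 1 ≤ idx (strands c).f := by
    exact_mod_cast (strands c).idx_lt hc
  refine ⟨h1.1.le, ?_, hc ▸ h2.2.le, ?_⟩
  · unfold fstTime sndTime; linarith [h.mem_Ioo.2, h.symm.mem_Ioo.1]
  · unfold fstTime sndTime
    rw [curve_time h]
    conv_rhs => rw [hc]
    rw [curve_time h.symm]

theorem fstTime_lt_sndTime (hc : (strands c).e.1 = (strands c).f.1) : fstTime c < sndTime c := by
  have h := (strands c).isCrossing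
  have h3 : (idx (strands c).e : ℝ) + 1 ≤ idx (strands c).f := by
    exact_mod_cast (strands c).idx_lt hc
  unfold fstTime sndTime; linarith [h.mem_Ioo.2, h.symm.mem_Ioo.1]

/-- The mod 2 winding number around a loop at a self-crossing point. -/
noncomputable def loopAt (c : P.crossings) : ℂ → ZMod 2 :=
  P.loopParity (strands c).e.1 (fstTime c) (sndTime c)

/-- The loop leaves along the forward arm of the first strand and returns along the backward arm of
the second. It therefore separates the corner `(true, false)` from the other three, as this lemma
and the next two record. -/
theorem loopAt_true_true (hc : (strands c).e.1 = (strands c).f.1) :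
    loopAt c (cornerPt c (true, true)) = loopAt c (cornerPt c (true, false)) + 1 :=
  (isLoop_times hc).flip_true (strands c).isCrossing rfl le_rfl (fstTime_lt_sndTime hc)

theorem loopAt_false_true (hc : (strands c).e.1 = (strands c).f.1) :
    loopAt c (cornerPt c (false, true)) = loopAt c (cornerPt c (false, false)) :=
  (isLoop_times hc).eq_false (strands c).isCrossing fun _ => Or.inl le_rfl

theorem loopAt_true_true_eq (hc : (strands c).e.1 = (strands c).f.1) :
    loopAt c (cornerPt c (true, true)) = loopAt c (cornerPt c (false, true)) := by
  have := (isLoop_times hc).eq_true (strands c).isCrossing.symm fun _ => Or.inr le_rfl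
  rwa [corner_symm _ _ _ _ true true, corner_symm _ _ _ _ false true] at this

-- Adjacent corners never share a region, and `loopAt c` separates `(true, false)` from `(false,
-- true)`; the only possible coincidence is `IsReducible`. In that case the shared region is counted
-- twice, hence not at all, by the corner sum, but once by `cornerRegions`.
open Classical in
theorem sum_cornerRegions (hc : (strands c).e.1 = (strands c).f.1) (X : Set ℂ → ZMod 2) :
    ∑ R ∈ cornerRegions c, X R = ∑ p, X (reg P (cornerPt c p)) +
      if IsReducible c then X (reg P (cornerPt c (true, true))) else 0 := by
  have hne : reg P (cornerPt c (true, false)) ≠ reg P (cornerPt c (false, true)) := by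
    intro heq
    have h1 := eq_of_reg_eq (isLoop_times hc).constOff (cornerPt_notMem c _) (cornerPt_notMem c _)
      heq
    change loopAt c _ = loopAt c _ at h1
    rw [← loopAt_true_true_eq hc, loopAt_true_true hc] at h1
    simp at h1
  split_ifs with h
  · have himg : cornerRegions c = {reg P (cornerPt c (true, true)),
        reg P (cornerPt c (true, false)), reg P (cornerPt c (false, true))} := by
      ext R
      simp only [cornerRegions, Finset.mem_image, Finset.mem_univ, true_and, Prod.exists,
        Bool.exists_bool, Finset.mem_insert, Finset.mem_singleton, ← show _ = _ from h, @eq_comm _ R]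
      tauto
    rw [himg, Finset.sum_insert, Finset.sum_insert, Finset.sum_singleton, sum_bool_prod,
      ← show _ = _ from h]
    · have : (2 : ZMod 2) = 0 := rfl
      linear_combination (-X (reg P (cornerPt c (true, true)))) * this
    · simpa using hne
    · simpa using ⟨reg_cornerPt_ne_snd c true, reg_cornerPt_ne_fst c true⟩
  · rw [add_zero, sum_cornerRegions_of_injective]
    exact injective_bool_prod (reg_cornerPt_ne_snd c) (reg_cornerPt_ne_fst c) h hne

end LinkProjection

/-! ### Position of the rest of the curve relative to a reducible loop -/

namespace LinkProjection

variable {n : ℕ} {P : LinkProjection n} {i : Fin n}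

theorem curve_mem_seg {U : ℝ} (hU : U ∈ Set.Ico (0 : ℝ) (P.size i)) :
    P.curve i U ∈ seg (P.edge i ⌊U⌋₊) := by
  have hm : ⌊U⌋₊ < P.size i := (Nat.floor_lt hU.1).2 hU.2
  have ht : U - ⌊U⌋₊ ∈ Set.Icc (0 : ℝ) 1 :=
    ⟨by linarith [Nat.floor_le hU.1], by linarith [Nat.lt_floor_add_one U]⟩
  have := curve_add (P := P) i hm ht
  rw [add_sub_cancel] at this
  exact this ▸ pt_mem_seg _ ht

theorem edge_floor_ne {U V : ℝ} (hU : U ∈ Set.Ico (0 : ℝ) (P.size i))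
    (hV : V ∈ Set.Ico (0 : ℝ) (P.size i)) (hne : U ≠ V) (h : P.curve i U = P.curve i V) :
    P.edge i ⌊U⌋₊ ≠ P.edge i ⌊V⌋₊ := by
  obtain ⟨m, hm, u, hu, rfl⟩ := exists_eq_add_lt hU
  obtain ⟨l, hl, v, hv, rfl⟩ := exists_eq_add_lt hV
  rw [curve_add i hm (Set.Ico_subset_Icc_self hu), curve_add i hl (Set.Ico_subset_Icc_self hv)] at h
  rw [add_comm (m : ℝ), add_comm (l : ℝ), Nat.floor_add_natCast hu.1, Nat.floor_add_natCast hv.1,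
    Nat.floor_eq_zero.2 hu.2, Nat.floor_eq_zero.2 hv.2, zero_add, zero_add]
  intro he
  obtain rfl := edge_eq_edge hm hl he
  exact hne (by rw [pt_injective _ h])

/-- Three passages through one point would use three different edges. The times are half-open
because `0` and `P.size i` give the same point. -/
theorem not_curve_eq_three {U V W : ℝ} (hU : U ∈ Set.Ico (0 : ℝ) (P.size i))
    (hV : V ∈ Set.Ico (0 : ℝ) (P.size i)) (hW : W ∈ Set.Ico (0 : ℝ) (P.size i)) (hUV : U ≠ V)
    (hVW : V ≠ W) (hUW : U ≠ W) (h1 : P.curve i U = P.curve i V) (h2 : P.curve i V = P.curve i W) :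
    False := by
  rcases eq_or_eq_of_mem_seg (edge_floor_ne hU hV hUV h1) (curve_mem_seg hU)
    (h1 ▸ curve_mem_seg hV) (h1.trans h2 ▸ curve_mem_seg hW) with h | h
  · exact edge_floor_ne hU hW hUW (h1.trans h2) h.symm
  · exact edge_floor_ne hV hW hVW h2 h.symm

/-- No rightward ray from such a point meets the component. In particular the base point, chosen
rightmost, has winding number 0 for every loop of its component. -/
theorem loopParity_eq_zero_of_re_le {S T : ℝ} {p : ℂ} (hp : (src (P.edge i 0)).re ≤ p.re) :
    P.loopParity i S T p = 0 := by
  have h : ∀ k (t : ℝ), t ∈ Set.Icc (0 : ℝ) 1 → (pt (P.edge i k) t).re ≤ p.re := by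
    intro k t ht
    have h1 : (src (P.edge i k)).re ≤ p.re := (re_le_rightmost (P.edge i k)).trans hp
    have h2 : (dst (P.edge i k)).re ≤ p.re := (re_le_rightmost (nxt (P.edge i k))).trans hp
    have : (pt (P.edge i k) t).re =
        (1 - t) * (src (P.edge i k)).re + t * (dst (P.edge i k)).re := by
      simp [pt, dir]; ring
    rw [this]
    nlinarith [mul_le_mul_of_nonneg_left h1 (sub_nonneg.2 ht.2),
      mul_le_mul_of_nonneg_left h2 ht.1]
  exact Finset.sum_eq_zero fun k _ =>
    rayParity_eq_zero_of_re_le (h k _ (clamp_mem _)) (h k _ (clamp_mem _))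

theorem IsLoop.constOff_image {S T : ℝ} (h : IsLoop P i S T) :
    ConstOff (P.loopParity i S T) (P.curve i '' Set.Icc S T) :=
  constOff_of_eventually_eq fun _ hx => h.eventually_loopParity_eq hx

theorem IsCrossing.corner_eq_self {α : Type*} {F : ℂ → α} {x : ℂ} {e f : P.Edge} {s t r : ℝ}
    (h : IsCrossing x e f s t r) (hF : ConstOff F P.polygons) (hev : ∀ᶠ p in 𝓝 x, F p = F x)
    (σ τ : Bool) : F (corner x e f r σ τ) = F x := by
  have htend : Tendsto (fun b : ℝ => x + (sg σ * b) • dir e + (sg τ * b) • dir f) (𝓝[>] 0) (𝓝 x) :=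
    tendsto_nhdsWithin_of_tendsto_nhds (Continuous.tendsto' (by fun_prop) _ _ (by simp))
  obtain ⟨b, hb, hb'⟩ := ((htend.eventually hev).and (Ioo_mem_nhdsGT h.r_pos)).exists
  rw [← hb, h.quadrant hF σ τ hb' hb']

/-- A loop that passes straight through a crossing point, along one strand only, separates
opposite corners. -/
theorem IsLoop.reg_corner_ne {U V : ℝ} (hl : IsLoop P i U V) {x : ℂ} {e f : P.Edge} {s t r : ℝ}
    (h : IsCrossing x e f s t r) (he : e.1 = i) (h1 : U < idx e + s) (h2 : idx e + s < V)
    (h3 : idx f + t < U ∨ V < idx f + t) :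
    reg P (corner x e f r true true) ≠ reg P (corner x e f r false false) := by
  intro heq
  have h4 := eq_of_reg_eq hl.constOff (corner_notMem h _ _) (corner_notMem h _ _) heq
  have h5 := hl.eq_false h.symm fun _ => h3.imp_left le_of_lt
  rw [corner_symm _ _ _ _ true false, corner_symm _ _ _ _ false false] at h5
  rw [hl.flip_true h he h1.le h2, h5] at h4
  simp at h4

variable {c : P.crossings}

theorem fstTime_mem (c : P.crossings) :
    fstTime c ∈ Set.Ioo (0 : ℝ) (P.size (strands c).e.1) := time_mem (strands c).isCrossing

theorem sndTime_mem (hc : (strands c).e.1 = (strands c).f.1) :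
    sndTime c ∈ Set.Ioo (0 : ℝ) (P.size (strands c).e.1) := by
  rw [hc]; exact time_mem (strands c).isCrossing.symm

theorem curve_fstTime (c : P.crossings) : P.curve (strands c).e.1 (fstTime c) = pos c :=
  curve_time (strands c).isCrossing

theorem curve_sndTime (hc : (strands c).e.1 = (strands c).f.1) :
    P.curve (strands c).e.1 (sndTime c) = pos c := by
  rw [hc]; exact curve_time (strands c).isCrossing.symm

/-- At a reducible crossing point, the two loops meet in this point only. -/
theorem curve_notMem_of_isReducible (hc : (strands c).e.1 = (strands c).f.1) (hred : IsReducible c)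
    {U : ℝ} (hU0 : 0 ≤ U) (hUN : U ≤ P.size (strands c).e.1)
    (hU : U < fstTime c ∨ sndTime c < U) :
    P.curve (strands c).e.1 U ∉ P.curve (strands c).e.1 '' Set.Icc (fstTime c) (sndTime c) := by
  wlog hlt : U < P.size (strands c).e.1 generalizing U
  · obtain rfl := le_antisymm hUN (not_lt.1 hlt)
    rw [curve_size]
    exact this le_rfl (Nat.cast_nonneg _) (Or.inl (fstTime_mem c).1)
      (Nat.cast_pos.2 (size_pos _))
  rintro ⟨V, hV, hVU⟩
  have hS := fstTime_mem c
  have hT := sndTime_mem hc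
  have hST := fstTime_lt_sndTime hc
  have hS' : fstTime c ∈ Set.Ico (0 : ℝ) (P.size (strands c).e.1) := ⟨hS.1.le, hS.2⟩
  have hT' : sndTime c ∈ Set.Ico (0 : ℝ) (P.size (strands c).e.1) := ⟨hT.1.le, hT.2⟩
  have hcST := (curve_fstTime c).trans (curve_sndTime hc).symm
  have hUS : U ≠ fstTime c := by rintro rfl; rcases hU with h | h <;> linarith
  have hUT : U ≠ sndTime c := by rintro rfl; rcases hU with h | h <;> linarith
  -- Otherwise `U` would be a third passage through the crossing point.
  have hVS : V ≠ fstTime c := by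
    rintro rfl
    exact not_curve_eq_three ⟨hU0, hlt⟩ hS' hT' hUS hST.ne hUT hVU.symm hcST
  have hVT : V ≠ sndTime c := by
    rintro rfl
    exact not_curve_eq_three ⟨hU0, hlt⟩ hT' hS' hUT hST.ne' hUS hVU.symm hcST.symm
  have hV1 : fstTime c < V := hV.1.lt_of_ne' hVS
  have hV2 : V < sndTime c := hV.2.lt_of_ne hVT
  -- If the two loops met elsewhere, the part of the curve between `U` and `V` would be a loop
  -- through `c` along exactly one strand. It would separate the opposite corners that share a
  -- region.
  rcases hU with hU | hU
  · have hl : IsLoop P (strands c).e.1 U V := ⟨hU0, by linarith, by linarith [hT.2], hVU.symm⟩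
    exact hl.reg_corner_ne (strands c).isCrossing rfl hU hV1 (Or.inr hV2) hred
  · have hl : IsLoop P (strands c).e.1 V U := ⟨by linarith [hS.1], by linarith, hlt.le, hVU⟩
    have := hl.reg_corner_ne (strands c).isCrossing.symm hc.symm hV2 hU (Or.inl hV1)
    rw [corner_symm _ _ _ _ true true, corner_symm _ _ _ _ false false] at this
    exact this hred

/-- At a reducible crossing point, one loop lies outside the other one. -/
theorem loopAt_curve_eq_zero (hc : (strands c).e.1 = (strands c).f.1) (hred : IsReducible c)
    {U : ℝ} (hU0 : 0 ≤ U) (hUN : U ≤ P.size (strands c).e.1)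
    (hU : U < fstTime c ∨ sndTime c < U) : loopAt c (P.curve (strands c).e.1 U) = 0 := by
  have h0 : loopAt c (P.curve (strands c).e.1 0) = 0 :=
    loopParity_eq_zero_of_re_le (by rw [curve_zero])
  have hT := sndTime_mem hc
  have hl := isLoop_times hc
  -- The rest of the component consists of two arcs, each joined to the base point without meeting
  -- the loop.
  rcases hU with hU | hU
  · rw [← h0]
    refine hl.constOff_image (P.curve (strands c).e.1 '' Set.Ico 0 (fstTime c))
      (isPreconnected_Ico.image _ (continuous_curve _).continuousOn) ?_ _ ⟨U, ⟨hU0, hU⟩, rfl⟩ _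
      ⟨0, ⟨le_rfl, (fstTime_mem c).1⟩, rfl⟩
    rw [Set.disjoint_left]
    rintro _ ⟨W, hW, rfl⟩
    exact curve_notMem_of_isReducible hc hred hW.1 (hW.2.le.trans (fstTime_mem c).2.le)
      (Or.inl hW.2)
  · rw [← h0, ← curve_size]
    refine hl.constOff_image (P.curve (strands c).e.1 '' Set.Ioc (sndTime c) (P.size _))
      (isPreconnected_Ioc.image _ (continuous_curve _).continuousOn) ?_ _ ⟨U, ⟨hU, hUN⟩, rfl⟩ _
      ⟨_, ⟨hT.2, le_rfl⟩, rfl⟩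
    rw [Set.disjoint_left]
    rintro _ ⟨W, hW, rfl⟩
    exact curve_notMem_of_isReducible hc hred (hT.1.le.trans hW.1.le) hW.2 (Or.inr hW.1)

/-- The corner `(false, true)` has the same value and borders the arm by which the curve first
arrives at `c`; that arm lies outside the loop. -/
theorem loopAt_cornerPt_self (hc : (strands c).e.1 = (strands c).f.1) (hred : IsReducible c) :
    loopAt c (cornerPt c (true, true)) = 0 := by
  have h := (strands c).isCrossing
  have hr := h.r_pos
  have ha : (strands c).r / 2 ∈ Set.Ioo 0 (strands c).r := ⟨by linarith, by linarith⟩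
  have hlt : idx (strands c).e + ((strands c).s + sg false * ((strands c).r / 2)) < fstTime c := by
    unfold fstTime; rw [sg_false]; linarith
  rw [loopAt_true_true_eq hc]
  have h1 := (isLoop_times hc).corner_eq h false true ha fun _ => Or.inl hlt
  refine h1.trans ?_
  have h2 := h.mem_left _ (h.abs_sg_lt false ha)
  have h3 := curve_add (P := P) _ (idx_lt (strands c).e) (Set.Ioo_subset_Icc_self h2)
  rw [edge_idx] at h3
  rw [← h3]
  exact loopAt_curve_eq_zero hc hred (add_nonneg (Nat.cast_nonneg _) h2.1.le)
    (hlt.le.trans (fstTime_mem c).2.le) (Or.inl hlt)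

/-- One passage through `d` outside the loop suffices: the loop then misses the point itself, so all
four corners have its value 0. -/
theorem loopAt_cornerPt_of_same (hc : (strands c).e.1 = (strands c).f.1) (hred : IsReducible c)
    {d : P.crossings} {U : ℝ} (hU0 : 0 ≤ U) (hUN : U ≤ P.size (strands c).e.1)
    (hU : U < fstTime c ∨ sndTime c < U) (hd : P.curve (strands c).e.1 U = pos d) (p : Bool × Bool) :
    loopAt c (cornerPt d p) = 0 := by
  have hl := isLoop_times hc
  refine ((strands d).isCrossing.corner_eq_self hl.constOff ?_ p.1 p.2).trans
    (hd ▸ loopAt_curve_eq_zero hc hred hU0 hUN hU)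
  refine hl.eventually_loopParity_eq ?_
  rw [← hd]
  exact curve_notMem_of_isReducible hc hred hU0 hUN hU

theorem curve_mem_seg_of_Icc {U : ℝ} (hU : U ∈ Set.Icc (0 : ℝ) (P.size i)) :
    ∃ e : P.Edge, e.1 = i ∧ P.curve i U ∈ seg e := by
  obtain ⟨m, hm, u, hu, rfl⟩ := exists_eq_add (size_pos i) hU
  exact ⟨P.edge i m, rfl, by rw [curve_add i hm hu]; exact pt_mem_seg _ hu⟩

/-- The component through `d` is connected and misses the loop. By `hre` its rightmost vertex is at
least as far right as the whole component of `c`, so the winding number is 0 along it. -/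
theorem loopAt_cornerPt_of_ne (hiso : ∀ e f : P.Edge, e.1 ≠ f.1 → Disjoint (seg e) (seg f))
    (hc : (strands c).e.1 = (strands c).f.1) {d : P.crossings}
    (hne : (strands d).e.1 ≠ (strands c).e.1)
    (hre : (src (P.edge (strands c).e.1 0)).re ≤ (src (P.edge (strands d).e.1 0)).re)
    (p : Bool × Bool) : loopAt c (cornerPt d p) = 0 := by
  have hl := isLoop_times hc
  have hdisj : ∀ U ∈ Set.Icc (0 : ℝ) (P.size (strands d).e.1), P.curve (strands d).e.1 U ∉
      P.curve (strands c).e.1 '' Set.Icc (fstTime c) (sndTime c) := by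
    rintro U hU ⟨V, hV, hVU⟩
    obtain ⟨e, he, he'⟩ := curve_mem_seg_of_Icc hU
    obtain ⟨f, hf, hf'⟩ := curve_mem_seg_of_Icc (P := P) (i := (strands c).e.1)
      ⟨(fstTime_mem c).1.le.trans hV.1, hV.2.trans (sndTime_mem hc).2.le⟩
    exact Set.disjoint_left.1 (hiso e f (by rw [he, hf]; exact hne)) he' (hVU ▸ hf')
  have ht : fstTime d ∈ Set.Icc (0 : ℝ) (P.size (strands d).e.1) :=
    Set.Ioo_subset_Icc_self (fstTime_mem d)
  have hev := hl.eventually_loopParity_eq (hdisj _ ht)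
  rw [curve_fstTime] at hev
  refine ((strands d).isCrossing.corner_eq_self hl.constOff hev p.1 p.2).trans ?_
  have h0 : loopAt c (P.curve (strands d).e.1 0) = 0 :=
    loopParity_eq_zero_of_re_le (by rwa [curve_zero])
  rw [← h0]
  refine Eq.trans (congrArg _ (curve_fstTime d).symm) ?_
  refine hl.constOff_image (P.curve (strands d).e.1 '' Set.Icc 0 (P.size (strands d).e.1))
    (isPreconnected_Icc.image _ (continuous_curve _).continuousOn) ?_ _ ⟨_, ht, rfl⟩ _
    ⟨0, ⟨le_rfl, Nat.cast_nonneg _⟩, rfl⟩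
  rw [Set.disjoint_left]
  rintro _ ⟨W, hW, rfl⟩
  exact hdisj W hW

theorem sum_loopAt_self (hc : (strands c).e.1 = (strands c).f.1) :
    ∑ p, loopAt c (cornerPt c p) = 1 := by
  rw [sum_bool_prod, loopAt_true_true hc, loopAt_false_true hc, ZMod.two_add_self, add_zero,
    add_right_comm, ZMod.two_add_self, zero_add]

/-- For `d ≠ c` the first strand at `d` lies near `d` either on the loop with both arms or off it
with both. The jumps across the two arms are therefore equal and cancel. Together with
`sum_loopAt_self`, the functions `loopAt c` are dual to the crossing points with respect to corner
sums. -/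
theorem sum_loopAt_of_ne (hc : (strands c).e.1 = (strands c).f.1) {d : P.crossings} (hne : d ≠ c) :
    ∑ p, loopAt c (cornerPt d p) = 0 := by
  have hl := isLoop_times hc
  have h := (strands d).isCrossing
  rw [sum_bool_prod]
  by_cases hin : (strands d).e.1 = (strands c).e.1 ∧ fstTime c ≤ fstTime d ∧ fstTime d ≤ sndTime c
  · obtain ⟨h1, h2, h3⟩ := hin
    have hd : P.curve (strands c).e.1 (fstTime d) = pos d := h1 ▸ curve_fstTime d
    have h4 : fstTime c ≠ fstTime d := fun h4 =>
      hne (pos_injective (by rw [← hd, ← h4, curve_fstTime]))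
    have h5 : fstTime d ≠ sndTime c := fun h5 =>
      hne (pos_injective (by rw [← hd, h5, curve_sndTime hc]))
    have e1 := hl.flip_true h h1 h2 (h3.lt_of_ne h5)
    have e2 := hl.flip_false h h1 (h2.lt_of_ne h4) h3
    unfold loopAt cornerPt
    rw [e1, e2]
    generalize P.loopParity _ _ _ _ = a
    generalize P.loopParity _ _ _ _ = b
    revert a b; decide
  · have hout : (strands d).e.1 = (strands c).e.1 →
        fstTime d < fstTime c ∨ sndTime c < fstTime d := by
      intro h1
      by_contra! h2
      exact hin ⟨h1, h2.1, h2.2⟩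
    have e1 := hl.eq_true h fun h1 => (hout h1).imp_right le_of_lt
    have e2 := hl.eq_false h fun h1 => (hout h1).imp_left le_of_lt
    unfold loopAt cornerPt
    rw [e1, e2, ZMod.two_add_self, ZMod.two_add_self, add_zero]

/-! ### Disjoint components: no nonzero weight vanishes on all regions -/

/-- Double counting of incident pairs; only the finitely many regions at corners, collected in `C`,
take part. -/
theorem sum_mul_sum_cornerRegions {w : P.crossings → ZMod 2}
    (hw : ∀ R, P.IsRegion R → ∑ c, w c * ind (c ∈ P.incident R) = 0) (X : Set ℂ → ZMod 2) :
    ∑ c, w c * ∑ R ∈ cornerRegions c, X R = 0 := by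
  classical
  have hreg : ∀ c : P.crossings, ∀ R ∈ cornerRegions c, P.IsRegion R := by
    intro c R hR
    simp only [cornerRegions, Finset.mem_image, Finset.mem_univ, true_and] at hR
    obtain ⟨p, rfl⟩ := hR
    exact isRegion_reg (cornerPt_notMem c p)
  let C : Finset (Set ℂ) := (Finset.univ : Finset P.crossings).biUnion cornerRegions
  have hC : ∀ R ∈ C, P.IsRegion R := by
    intro R hR
    obtain ⟨c, -, hc⟩ := Finset.mem_biUnion.1 hR
    exact hreg c R hc
  have h1 : ∀ c : P.crossings, ∑ R ∈ cornerRegions c, X R =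
      ∑ R ∈ C, X R * ind (c ∈ P.incident R) := by
    intro c
    rw [← Finset.sum_subset (Finset.subset_biUnion_of_mem cornerRegions (Finset.mem_univ c))]
    · refine Finset.sum_congr rfl fun R hR => ?_
      rw [ind_true ((mem_cornerRegions_iff c (hreg c R hR)).1 hR), mul_one]
    · intro R hR hRc
      rw [ind_false fun h => hRc ((mem_cornerRegions_iff c (hC R hR)).2 h), mul_zero]
  simp only [h1, Finset.mul_sum]
  rw [Finset.sum_comm]
  refine Finset.sum_eq_zero fun R hR => ?_
  rw [← mul_zero (X R), ← hw R (hC R hR), Finset.mul_sum]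
  exact Finset.sum_congr rfl fun c _ => by ring

/-- If the components are disjoint, no nonempty set of crossing points has an even number of points
in common with the boundary of every region. -/
theorem eq_zero_of_sum_incident_eq_zero
    (hiso : ∀ e f : P.Edge, e.1 ≠ f.1 → Disjoint (seg e) (seg f)) {w : P.crossings → ZMod 2}
    (hw : ∀ R, P.IsRegion R → ∑ c, w c * ind (c ∈ P.incident R) = 0) : w = 0 := by
  classical
  have hself : ∀ c : P.crossings, (strands c).e.1 = (strands c).f.1 := by
    intro c
    by_contra h
    exact Set.disjoint_left.1 (hiso _ _ h) (strands c).isCrossing.mem_left_seg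
      (strands c).isCrossing.symm.mem_left_seg
  -- Pairing `w` with `loopAt c` leaves `w c` plus the correction terms at reducible crossing
  -- points. If all of these vanished, so would `w c`.
  have key : ∀ c, w c ≠ 0 → ∃ d, w d ≠ 0 ∧ IsReducible d ∧
      loopAt c (cornerPt d (true, true)) ≠ 0 := by
    intro c hwc
    by_contra! hcon
    obtain ⟨X, hX⟩ := exists_region_function (isLoop_times (hself c)).constOff
    have h1 := sum_mul_sum_cornerRegions hw X
    refine hwc ?_
    rw [← h1, Finset.sum_eq_single c]
    · rw [sum_cornerRegions (hself c)]
      simp only [hX _ (cornerPt_notMem _ _)]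
      change w c = w c * (∑ p, loopAt c (cornerPt c p) +
        if IsReducible c then loopAt c (cornerPt c (true, true)) else 0)
      rw [sum_loopAt_self (hself c)]
      split_ifs with h
      · rw [hcon c hwc h, add_zero, mul_one]
      · rw [add_zero, mul_one]
    · intro d _ hdc
      rw [sum_cornerRegions (hself d)]
      simp only [hX _ (cornerPt_notMem _ _)]
      change w d * (∑ p, loopAt c (cornerPt d p) +
        if IsReducible d then loopAt c (cornerPt d (true, true)) else 0) = 0
      rw [sum_loopAt_of_ne (hself c) hdc, zero_add]
      split_ifs with h
      · by_cases hwd : w d = 0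
        · rw [hwd, zero_mul]
        · rw [hcon d hwd h, mul_zero]
      · exact mul_zero _
    · intro h; exact absurd (Finset.mem_univ c) h
  by_contra hne
  obtain ⟨c₀, hc₀⟩ := Function.ne_iff.1 hne
  obtain ⟨c₁, hc₁, hr₁, -⟩ := key c₀ hc₀
  -- The first minimum selects a component whose rightmost vertex is as far left as possible; this
  -- handles `d` on other components. The second selects a shortest loop on it; this handles `d` on
  -- the same component.
  obtain ⟨c₂, hc₂, hmin₂⟩ := Finset.exists_min_image
    (Finset.univ.filter fun c : P.crossings => w c ≠ 0 ∧ IsReducible c)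
    (fun c => (src (P.edge (strands c).e.1 0)).re) ⟨c₁, by simp [hc₁, hr₁]⟩
  obtain ⟨c, hc, hmin⟩ := Finset.exists_min_image
    (Finset.univ.filter fun c : P.crossings => (w c ≠ 0 ∧ IsReducible c) ∧
      (strands c).e.1 = (strands c₂).e.1) (fun c => sndTime c - fstTime c)
    ⟨c₂, by simpa using hc₂⟩
  simp only [Finset.mem_filter, Finset.mem_univ, true_and] at hc hc₂ hmin hmin₂
  obtain ⟨⟨hwc, hred⟩, hcomp⟩ := hc
  obtain ⟨d, hwd, hredd, hd⟩ := key c hwc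
  refine hd ?_
  by_cases hdc : d = c
  · subst hdc
    exact loopAt_cornerPt_self (hself d) hred
  by_cases hsame : (strands d).e.1 = (strands c).e.1
  · have h1 := hmin d ⟨⟨hwd, hredd⟩, hsame.trans hcomp⟩
    have hd1 : P.curve (strands c).e.1 (fstTime d) = pos d := hsame ▸ curve_fstTime d
    have hd2 : P.curve (strands c).e.1 (sndTime d) = pos d := hsame ▸ curve_sndTime (hself d)
    have m1 := fstTime_mem d
    have m2 := sndTime_mem (hself d)
    rw [hsame] at m1 m2
    have hne1 : fstTime d ≠ fstTime c := fun h =>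
      hdc (pos_injective (by rw [← hd1, h, curve_fstTime]))
    -- The loop of `d` is no shorter than that of `c`, so at least one passage through `d` lies
    -- outside the loop of `c`.
    by_cases h2 : fstTime d < fstTime c
    · exact loopAt_cornerPt_of_same (hself c) hred m1.1.le m1.2.le (Or.inl h2) hd1 _
    · have : fstTime c < fstTime d := (not_lt.1 h2).lt_of_ne' hne1
      exact loopAt_cornerPt_of_same (hself c) hred m2.1.le m2.2.le (Or.inr (by linarith)) hd2 _
  · exact loopAt_cornerPt_of_ne hiso (hself c) hsame (by
      rw [hcomp]; exact hmin₂ d ⟨hwd, hredd⟩) _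

end LinkProjection

/-! ### Sums over the two sides of an edge -/

theorem eventually_nhdsWithin_eventually_nhds {X : Type*} [TopologicalSpace X] {U : Set X}
    (hU : IsOpen U) {a : X} {Q : X → Prop} (h : ∀ᶠ z in 𝓝[U] a, Q z) :
    ∀ᶠ y in 𝓝[U] a, ∀ᶠ z in 𝓝 y, Q z := by
  rw [eventually_nhdsWithin_iff] at h ⊢
  filter_upwards [eventually_eventually_nhds.2 h] with y hy hyU
  filter_upwards [hy, hU.mem_nhds hyU] with z hz hzU using hz hzU

/-- The total change along the unit interval of a quantity that is locally constant except for
finitely many jumps. -/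
theorem total_change_eq_sum_jumps {ι : Type*} {J : ℝ → ZMod 2 → Prop}
    (huniq : ∀ τ v w, J τ v → J τ w → v = w) (A : Finset ι) (t : ι → ℝ) (δ : ι → ZMod 2)
    (hloc : ∀ τ ∈ Set.Ioo (0 : ℝ) 1, ∃ v w, (∀ᶠ τ' in 𝓝[<] τ, J τ' v) ∧
      (∀ᶠ τ' in 𝓝[>] τ, J τ' w) ∧ w = v + ∑ c ∈ A, if t c = τ then δ c else 0)
    (ht : ∀ c ∈ A, t c ∈ Set.Ioo (0 : ℝ) 1) {v₀ v₁ : ZMod 2} (h0 : ∀ᶠ τ in 𝓝[>] (0 : ℝ), J τ v₀)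
    (h1 : ∀ᶠ τ in 𝓝[<] (1 : ℝ), J τ v₁) : v₁ = v₀ + ∑ c ∈ A, δ c := by
  -- `G` is the running total of the jumps. After subtracting it, the quantity has one value `u τ`
  -- on a punctured neighbourhood of each `τ`; at `τ` itself `J` may have no value. Overlapping
  -- neighbourhoods make `u` locally constant.
  set G : ℝ → ZMod 2 := fun τ => ∑ c ∈ A, if t c < τ then δ c else 0 with hG
  have key : ∀ τ ∈ Set.Ioo (0 : ℝ) 1, ∃ u, ∀ᶠ τ' in 𝓝[≠] τ, J τ' (u + G τ') := by
    intro τ hτ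
    obtain ⟨v, w, hv, hw, hvw⟩ := hloc τ hτ
    refine ⟨v - G τ, ?_⟩
    rw [← Set.Iio_union_Ioi, nhdsWithin_union, eventually_sup]
    constructor
    · have : ∀ᶠ τ' in 𝓝[<] τ, ∀ c ∈ A, (t c < τ' ↔ t c < τ) := by
        rw [eventually_all_finset]
        intro c _
        by_cases hc : t c < τ
        · filter_upwards [Ioo_mem_nhdsLT hc] with τ' h using ⟨fun _ => hc, fun _ => h.1⟩
        · filter_upwards [self_mem_nhdsWithin] with τ' h
          exact ⟨fun h' => h'.trans h, fun h' => absurd h' hc⟩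
      filter_upwards [hv, this] with τ' h1 h2
      have : G τ' = G τ := Finset.sum_congr rfl fun c hc => by simp only [h2 c hc]
      rwa [this, sub_add_cancel]
    · have : ∀ᶠ τ' in 𝓝[>] τ, ∀ c ∈ A, (t c < τ' ↔ t c ≤ τ) := by
        rw [eventually_all_finset]
        intro c _
        by_cases hc : t c ≤ τ
        · filter_upwards [self_mem_nhdsWithin] with τ' h using ⟨fun _ => hc, fun _ => hc.trans_lt h⟩
        · filter_upwards [Ioo_mem_nhdsGT (not_le.1 hc)] with τ' h
          exact ⟨fun h' => absurd h' h.2.not_gt, fun h' => absurd h' hc⟩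
      filter_upwards [hw, this] with τ' h1 h2
      have : G τ' = G τ + ∑ c ∈ A, if t c = τ then δ c else 0 := by
        rw [hG, ← Finset.sum_add_distrib]
        refine Finset.sum_congr rfl fun c hc => ?_
        simp only [h2 c hc]
        rcases lt_trichotomy (t c) τ with h | h | h
        · simp [h, h.le, h.ne]
        · simp [h]
        · simp [h.not_gt, h.not_ge, h.ne']
      rw [this, show v - G τ + (G τ + ∑ c ∈ A, if t c = τ then δ c else 0) = w by rw [hvw]; ring]
      exact h1
  choose! u hu using key
  have hconst : ∀ p ∈ Set.Ioo (0 : ℝ) 1, ∀ q ∈ Set.Ioo (0 : ℝ) 1, u p = u q := by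
    intro p hp q hq
    let _ : TopologicalSpace (ZMod 2) := ⊥
    have : DiscreteTopology (ZMod 2) := ⟨rfl⟩
    refine isPreconnected_Ioo.constant (f := u) (fun τ hτ => ?_) hp hq
    refine ContinuousAt.continuousWithinAt ?_
    refine (continuousAt_const (y := u τ)).congr ?_
    have h2 := eventually_nhdsWithin_eventually_nhds isOpen_compl_singleton (hu τ hτ)
    rw [eventually_nhdsWithin_iff] at h2
    filter_upwards [h2, isOpen_Ioo.mem_nhds hτ] with y hy hyI
    by_cases hyτ : y = τ
    · rw [hyτ]
    · obtain ⟨z, hz1, hz2⟩ := ((hu y hyI).and ((hy hyτ).filter_mono nhdsWithin_le_nhds)).exists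
      exact add_right_cancel (huniq _ _ _ hz2 hz1)
  have e0 : ∃ p ∈ Set.Ioo (0 : ℝ) 1, v₀ = u p := by
    have : ∀ᶠ τ in 𝓝[>] (0 : ℝ), G τ = 0 := by
      have : ∀ᶠ τ in 𝓝[>] (0 : ℝ), ∀ c ∈ A, τ < t c := by
        rw [eventually_all_finset]
        intro c hc
        filter_upwards [Ioo_mem_nhdsGT (ht c hc).1] with τ h using h.2
      filter_upwards [this] with τ h
      exact Finset.sum_eq_zero fun c hc => if_neg (h c hc).not_gt
    obtain ⟨p, hp, hpI⟩ := ((eventually_nhdsWithin_eventually_nhds isOpen_Ioi (h0.and this)).and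
      (Ioo_mem_nhdsGT one_pos)).exists
    obtain ⟨z, hz1, hz2, hz3⟩ := ((hu p hpI).and (hp.filter_mono nhdsWithin_le_nhds)).exists
    rw [hz3, add_zero] at hz1
    exact ⟨p, hpI, huniq _ _ _ hz2 hz1⟩
  have e1 : ∃ p ∈ Set.Ioo (0 : ℝ) 1, v₁ = u p + ∑ c ∈ A, δ c := by
    have : ∀ᶠ τ in 𝓝[<] (1 : ℝ), G τ = ∑ c ∈ A, δ c := by
      have : ∀ᶠ τ in 𝓝[<] (1 : ℝ), ∀ c ∈ A, t c < τ := by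
        rw [eventually_all_finset]
        intro c hc
        filter_upwards [Ioo_mem_nhdsLT (ht c hc).2] with τ h using h.1
      filter_upwards [this] with τ h
      exact Finset.sum_congr rfl fun c hc => if_pos (h c hc)
    obtain ⟨p, hp, hpI⟩ := ((eventually_nhdsWithin_eventually_nhds isOpen_Iio (h1.and this)).and
      (Ioo_mem_nhdsLT zero_lt_one)).exists
    obtain ⟨z, hz1, hz2, hz3⟩ := ((hu p hpI).and (hp.filter_mono nhdsWithin_le_nhds)).exists
    rw [hz3] at hz1
    exact ⟨p, hpI, huniq _ _ _ hz2 hz1⟩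
  obtain ⟨p, hp, rfl⟩ := e0
  obtain ⟨q, hq, rfl⟩ := e1
  rw [hconst q hq p hp]

theorem crossProd_sub_right (u v w : ℂ) : crossProd u (v - w) = crossProd u v - crossProd u w := by
  simp [crossProd]; ring

theorem isLinearMap_crossProd (u : ℂ) : IsLinearMap ℝ (crossProd u) :=
  ⟨crossProd_add_right u, fun a v => crossProd_smul_right u v a⟩

theorem crossProd_I_mul_self_pos {u : ℂ} (hu : u ≠ 0) : 0 < crossProd u (Complex.I * u) := by
  have : crossProd u (Complex.I * u) = Complex.normSq u := by
    simp [crossProd, Complex.normSq_apply]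
  rw [this]; exact Complex.normSq_pos.2 hu

namespace LinkProjection

variable {n : ℕ} {P : LinkProjection n}

/-- The sum of the values of `W` on both sides of an edge, at a point of this edge, is `v`. -/
def SideSum (W : ℂ → ZMod 2) (e : P.Edge) (τ : ℝ) (v : ZMod 2) : Prop :=
  ∀ᶠ b in 𝓝[>] (0 : ℝ), W (pt e τ + b • (Complex.I * dir e)) +
    W (pt e τ - b • (Complex.I * dir e)) = v

theorem SideSum.unique {W : ℂ → ZMod 2} {e : P.Edge} {τ : ℝ} {v w : ZMod 2}
    (hv : SideSum W e τ v) (hw : SideSum W e τ w) : v = w := by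
  obtain ⟨b, h1, h2⟩ := (hv.and hw).exists
  exact h1.symm.trans h2

variable {W : ℂ → ZMod 2}

/-- Where the polygons are locally contained in a line, the sum of the values on both sides of this
line is locally constant. -/
theorem exists_sideSum (hW : ConstOff W P.polygons) {y d : ℂ}
    (hy : ∀ᶠ z in 𝓝 y, z ∈ P.polygons → crossProd d (z - y) = 0) :
    ∃ ρ > 0, ∀ p p', dist p y < ρ → dist p' y < ρ → 0 < crossProd d (p - y) →
      crossProd d (p' - y) < 0 → ∀ (e : P.Edge) (τ l : ℝ), 0 < l → dir e = l • d → pt e τ = y →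
      ∀ᶠ τ' in 𝓝 τ, SideSum W e τ' (W p + W p') := by
  obtain ⟨ρ, hρ, hball⟩ := Metric.eventually_nhds_iff.1 hy
  refine ⟨ρ, hρ, fun p p' hp hp' hpos hneg e τ l hl hle hey => ?_⟩
  -- An open half-ball on one side of the line is convex and misses the polygons.
  have hup : ∀ z, dist z y < ρ → 0 < crossProd d (z - y) → W z = W p := by
    intro z hz hz'
    refine hW (Metric.ball y ρ ∩ {z | crossProd d y < crossProd d z})
      ((convex_ball y ρ).inter (convex_halfSpace_gt (isLinearMap_crossProd d) _)).isPreconnected ?_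
      _ ⟨hz, ?_⟩ _ ⟨hp, ?_⟩
    · rw [Set.disjoint_left]
      rintro q ⟨hq, hq'⟩ hqP
      have := hball hq hqP
      rw [crossProd_sub_right] at this
      have hq'' : crossProd d y < crossProd d q := hq'
      linarith
    all_goals
      simp only [crossProd_sub_right] at hz' hpos
      change crossProd d y < _
      linarith
  have hdn : ∀ z, dist z y < ρ → crossProd d (z - y) < 0 → W z = W p' := by
    intro z hz hz'
    refine hW (Metric.ball y ρ ∩ {z | crossProd d z < crossProd d y})
      ((convex_ball y ρ).inter (convex_halfSpace_lt (isLinearMap_crossProd d) _)).isPreconnected ?_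
      _ ⟨hz, ?_⟩ _ ⟨hp', ?_⟩
    · rw [Set.disjoint_left]
      rintro q ⟨hq, hq'⟩ hqP
      have := hball hq hqP
      rw [crossProd_sub_right] at this
      have hq'' : crossProd d q < crossProd d y := hq'
      linarith
    all_goals
      simp only [crossProd_sub_right] at hz' hneg
      change _ < crossProd d y
      linarith
  have hnear : ∀ᶠ τ' in 𝓝 τ, pt e τ' ∈ Metric.ball y ρ :=
    ((continuous_pt e).tendsto' τ y hey).eventually (Metric.ball_mem_nhds y hρ)
  filter_upwards [hnear] with τ' hτ'
  have hd0 : d ≠ 0 := by rintro rfl; exact dir_ne_zero e (by simpa using hle)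
  have hcr : ∀ b : ℝ, crossProd d (pt e τ' + b • (Complex.I * dir e) - y) =
      b * (l * crossProd d (Complex.I * d)) := by
    intro b
    rw [← hey, hle]
    have : pt e τ' = pt e τ + ((τ' - τ) * l) • d := by
      rw [mul_smul, ← hle, ← pt_add]; congr 1; ring
    rw [this]; simp [crossProd]; ring
  have hI := mul_pos hl (crossProd_I_mul_self_pos hd0)
  have t1 : Tendsto (fun b : ℝ => pt e τ' + b • (Complex.I * dir e)) (𝓝[>] 0) (𝓝 (pt e τ')) :=
    tendsto_nhdsWithin_of_tendsto_nhds (Continuous.tendsto' (by fun_prop) _ _ (by simp))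
  have t2 : Tendsto (fun b : ℝ => pt e τ' - b • (Complex.I * dir e)) (𝓝[>] 0) (𝓝 (pt e τ')) :=
    tendsto_nhdsWithin_of_tendsto_nhds (Continuous.tendsto' (by fun_prop) _ _ (by simp))
  filter_upwards [t1.eventually (Metric.isOpen_ball.mem_nhds hτ'),
    t2.eventually (Metric.isOpen_ball.mem_nhds hτ'), self_mem_nhdsWithin] with b h1 h2 hb
  have hb : 0 < b := hb
  rw [hup _ h1 (by rw [hcr]; positivity), hdn _ h2 ?_]
  rw [sub_eq_add_neg (pt e τ'), ← neg_smul, hcr]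
  nlinarith [mul_pos hb hI]

theorem eventually_crossProd_eq_zero {e : P.Edge} {y : ℂ} (hye : y ∈ seg e)
    (hy : ∀ g, y ∈ seg g → g = e) :
    ∀ᶠ z in 𝓝 y, z ∈ P.polygons → crossProd (dir e) (z - y) = 0 := by
  filter_upwards [eventually_mem_seg (P := P) y] with z hz hzP
  obtain ⟨g, hg⟩ := Set.mem_iUnion.1 hzP
  obtain rfl := hy g (hz g hg)
  obtain ⟨u, -, rfl⟩ := mem_seg_iff.1 hg
  obtain ⟨v, -, rfl⟩ := mem_seg_iff.1 hye
  have : pt g u - pt g v = (u - v) • dir g := by simp only [pt, sub_smul]; ring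
  rw [this, crossProd_smul_right, crossProd_self, mul_zero]

/-- Off the crossing points, the sides of an edge can be reached along any transverse vector. -/
theorem sideSum_of_transverse (hW : ConstOff W P.polygons) {e : P.Edge} {τ : ℝ}
    (hye : pt e τ ∈ seg e) (hy : ∀ g, pt e τ ∈ seg g → g = e) {d : ℂ}
    (hd : crossProd (dir e) d ≠ 0) :
    ∀ᶠ b in 𝓝[>] (0 : ℝ), ∀ᶠ τ' in 𝓝 τ, SideSum W e τ' (W (pt e τ + b • d) + W (pt e τ - b • d)) := by
  obtain ⟨ρ, hρ, h⟩ := exists_sideSum hW (eventually_crossProd_eq_zero hye hy)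
  have t1 : Tendsto (fun b : ℝ => pt e τ + b • d) (𝓝[>] 0) (𝓝 (pt e τ)) :=
    tendsto_nhdsWithin_of_tendsto_nhds (Continuous.tendsto' (by fun_prop) _ _ (by simp))
  have t2 : Tendsto (fun b : ℝ => pt e τ - b • d) (𝓝[>] 0) (𝓝 (pt e τ)) :=
    tendsto_nhdsWithin_of_tendsto_nhds (Continuous.tendsto' (by fun_prop) _ _ (by simp))
  filter_upwards [t1.eventually (Metric.ball_mem_nhds _ hρ),
    t2.eventually (Metric.ball_mem_nhds _ hρ), self_mem_nhdsWithin] with b h1 h2 hb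
  have hb : 0 < b := hb
  have c1 : crossProd (dir e) (pt e τ + b • d - pt e τ) = b * crossProd (dir e) d := by
    rw [add_sub_cancel_left, crossProd_smul_right]
  have c2 : crossProd (dir e) (pt e τ - b • d - pt e τ) = -(b * crossProd (dir e) d) := by
    rw [sub_sub_cancel_left, ← neg_smul, crossProd_smul_right]; ring
  rcases hd.lt_or_gt with hd | hd
  · rw [add_comm (W _)]
    exact h _ _ h2 h1 (by rw [c2]; nlinarith) (by rw [c1]; nlinarith) e τ 1 one_pos
      (one_smul _ _).symm rfl
  · exact h _ _ h1 h2 (by rw [c1]; positivity) (by rw [c2, neg_neg_iff_pos]; positivity) e τ 1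
      one_pos (one_smul _ _).symm rfl

theorem IsCrossing.sideSum (hW : ConstOff W P.polygons) {x : ℂ} {e f : P.Edge} {s t r : ℝ}
    (h : IsCrossing x e f s t r) (σ : Bool) {a : ℝ} (ha : a ∈ Set.Ioo 0 r) :
    SideSum W e (s + sg σ * a) (W (corner x e f r σ true) + W (corner x e f r σ false)) := by
  have h1 := h.abs_sg_lt σ ha
  obtain ⟨b, hb, hb'⟩ := ((sideSum_of_transverse hW
    (pt_mem_seg e (Set.Ioo_subset_Icc_self (h.mem_left _ h1)))
    (h.arm_left _ (mul_ne_zero (sg_ne_zero σ) ha.1.ne') h1) h.indep).and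
    (Ioo_mem_nhdsGT h.r_pos)).exists
  have := hb.self_of_nhds
  rw [h.pt_add] at this
  rw [← h.quadrant hW σ true ha hb', ← h.quadrant hW σ false ha hb']
  simpa [sub_eq_add_neg] using this

theorem notVertex_pt (e : P.Edge) {t : ℝ} (ht : t ∈ Set.Ioo (0 : ℝ) 1) :
    NotVertex P (pt e t) := by
  intro g hg
  rcases eq_or_eq_nxt_of_src_mem (hg ▸ pt_mem_seg e ⟨ht.1.le, ht.2.le⟩ : src g ∈ seg e) with
    rfl | rfl
  · rw [← pt_zero] at hg
    exact ht.1.ne' (pt_injective _ hg)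
  · rw [← dst, ← pt_one] at hg
    exact ht.2.ne (pt_injective _ hg)

theorem eq_or_eq_nxt_of_dst_mem {e g : P.Edge} (h : dst e ∈ seg g) : g = e ∨ g = nxt e := by
  rcases eq_or_eq_nxt_of_src_mem h with h | h
  · exact Or.inr h.symm
  · exact Or.inl (nxt_injective h).symm

/-- The sum of the values of both sides does not change at a vertex. -/
theorem exists_sideSum_at_vertex (hW : ConstOff W P.polygons) (e : P.Edge) :
    ∃ v, (∀ᶠ τ in 𝓝[<] (1 : ℝ), SideSum W e τ v) ∧
      ∀ᶠ τ in 𝓝[>] (0 : ℝ), SideSum W (nxt e) τ v := by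
  by_cases hcr : crossProd (dir e) (dir (nxt e)) = 0
  · obtain ⟨l, hl, hdir⟩ := exists_dir_nxt_eq_smul hcr
    have hy : ∀ᶠ z in 𝓝 (dst e), z ∈ P.polygons → crossProd (dir e) (z - dst e) = 0 := by
      filter_upwards [eventually_mem_seg (P := P) (dst e)] with z hz hzP
      obtain ⟨g, hg⟩ := Set.mem_iUnion.1 hzP
      rcases eq_or_eq_nxt_of_dst_mem (hz g hg) with rfl | rfl
      · obtain ⟨u, -, rfl⟩ := mem_seg_iff.1 hg
        have : pt g u - dst g = (u - 1) • dir g := by simp only [pt, dir, sub_smul, one_smul]; ring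
        rw [this, crossProd_smul_right, crossProd_self, mul_zero]
      · obtain ⟨u, -, rfl⟩ := mem_seg_iff.1 hg
        have : pt (nxt e) u - dst e = (u * l) • dir e := by
          rw [mul_smul, ← hdir, pt, dst]; ring
        rw [this, crossProd_smul_right, crossProd_self, mul_zero]
    obtain ⟨ρ, hρ, h⟩ := exists_sideSum hW hy
    have hI := crossProd_I_mul_self_pos (dir_ne_zero e)
    have t1 : Tendsto (fun b : ℝ => dst e + b • (Complex.I * dir e)) (𝓝[>] 0) (𝓝 (dst e)) :=
      tendsto_nhdsWithin_of_tendsto_nhds (Continuous.tendsto' (by fun_prop) _ _ (by simp))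
    have t2 : Tendsto (fun b : ℝ => dst e - b • (Complex.I * dir e)) (𝓝[>] 0) (𝓝 (dst e)) :=
      tendsto_nhdsWithin_of_tendsto_nhds (Continuous.tendsto' (by fun_prop) _ _ (by simp))
    obtain ⟨b, ⟨h1, h2⟩, hb⟩ := (((t1.eventually (Metric.ball_mem_nhds _ hρ)).and
      (t2.eventually (Metric.ball_mem_nhds _ hρ))).and self_mem_nhdsWithin).exists
    have hb : 0 < b := hb
    have h3 := h _ _ h1 h2 (by rw [add_sub_cancel_left, crossProd_smul_right]; positivity)
      (by
        rw [sub_sub_cancel_left, ← neg_smul, crossProd_smul_right]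
        nlinarith [mul_pos hb hI])
    exact ⟨_, (h3 e 1 1 one_pos (one_smul _ _).symm (pt_one e)).filter_mono nhdsWithin_le_nhds,
      (h3 (nxt e) 0 l hl hdir (pt_zero _)).filter_mono nhdsWithin_le_nhds⟩
  -- At a genuine corner, oblique coordinates put `e` on the negative first axis and `f` on the
  -- positive second axis. One sector is the open second quadrant (`hup`). The other is not convex,
  -- but it is covered by two overlapping convex pieces (`hlow`, `hright`).
  · set x := dst e with hx
    set f := nxt e with hf
    have htend : Tendsto (fun ab : ℝ × ℝ => x + ab.1 • dir e + ab.2 • dir f) (𝓝 (0, 0)) (𝓝 x) :=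
      Continuous.tendsto' (by fun_prop) _ _ (by simp)
    obtain ⟨r, hr, hball⟩ := Metric.eventually_nhds_iff.1
      (htend.eventually (eventually_mem_seg (P := P) x))
    have hon : ∀ a b : ℝ, |a| < r → |b| < r → ∀ g, x + a • dir e + b • dir f ∈ seg g →
        (g = e ∧ b = 0 ∧ a ≤ 0) ∨ (g = f ∧ a = 0 ∧ 0 ≤ b) := by
      intro a b ha hb g hg
      have hd : dist (a, b) ((0 : ℝ), (0 : ℝ)) < r := by rw [Prod.dist_eq]; simp [ha, hb]
      rcases eq_or_eq_nxt_of_dst_mem (hball hd g hg) with rfl | rfl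
      · obtain ⟨u, hu01, hu⟩ := mem_seg_iff.1 hg
        have : (a - (u - 1)) • dir g + b • dir f = 0 := by
          have e1 : pt g u = x + (u - 1) • dir g := by
            rw [hx, ← pt_one, ← pt_add]; congr 1; ring
          rw [e1] at hu
          rw [sub_smul]
          linear_combination -hu
        have := smul_add_smul_eq_zero hcr this
        exact Or.inl ⟨rfl, this.2, by linarith [this.1, hu01.2]⟩
      · obtain ⟨u, hu01, hu⟩ := mem_seg_iff.1 hg
        have : a • dir e + (b - u) • dir (nxt e) = 0 := by
          have e1 : pt (nxt e) u = x + u • dir (nxt e) := rfl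
          rw [e1] at hu
          rw [sub_smul]
          linear_combination -hu
        have := smul_add_smul_eq_zero hcr this
        exact Or.inr ⟨rfl, this.1, by linarith [this.2, hu01.1]⟩
    have hconst : ∀ D : Set (ℝ × ℝ), Convex ℝ D → (∀ q ∈ D, |q.1| < r ∧ |q.2| < r ∧
        ¬ (q.2 = 0 ∧ q.1 ≤ 0) ∧ ¬ (q.1 = 0 ∧ 0 ≤ q.2)) → ∀ a b a' b', (a, b) ∈ D → (a', b') ∈ D →
        W (x + a • dir e + b • dir f) = W (x + a' • dir e + b' • dir f) := by
      intro D hD hav a b a' b' h1 h2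
      refine hW ((fun ab : ℝ × ℝ => x + ab.1 • dir e + ab.2 • dir f) '' D)
        (hD.isPreconnected.image _ (by fun_prop)) ?_ _ ⟨_, h1, rfl⟩ _ ⟨_, h2, rfl⟩
      rw [Set.disjoint_left]
      rintro _ ⟨q, hq, rfl⟩ hmem
      obtain ⟨g, hg⟩ := Set.mem_iUnion.1 hmem
      obtain ⟨k1, k2, k3, k4⟩ := hav q hq
      rcases hon _ _ k1 k2 g hg with h | h
      · exact k3 h.2
      · exact k4 h.2
    have hI : ∀ {a : ℝ}, a ∈ Set.Ioo (-r) r → |a| < r := fun h => abs_lt.2 h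
    have hlow : ∀ a b a' b' : ℝ, a ∈ Set.Ioo (-r) r → b ∈ Set.Ioo (-r) 0 → a' ∈ Set.Ioo (-r) r →
        b' ∈ Set.Ioo (-r) 0 →
        W (x + a • dir e + b • dir f) = W (x + a' • dir e + b' • dir f) := by
      intro a b a' b' ha hb ha' hb'
      refine hconst (Set.Ioo (-r) r ×ˢ Set.Ioo (-r) 0) ((convex_Ioo _ _).prod (convex_Ioo _ _))
        (fun q hq => ⟨hI hq.1, hI ⟨hq.2.1, hq.2.2.trans hr⟩, ?_, ?_⟩) _ _ _ _ ⟨ha, hb⟩ ⟨ha', hb'⟩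
      · exact fun h => hq.2.2.ne h.1
      · exact fun h => hq.2.2.not_ge h.2
    have hright : ∀ a b a' b' : ℝ, a ∈ Set.Ioo 0 r → b ∈ Set.Ioo (-r) r → a' ∈ Set.Ioo 0 r →
        b' ∈ Set.Ioo (-r) r →
        W (x + a • dir e + b • dir f) = W (x + a' • dir e + b' • dir f) := by
      intro a b a' b' ha hb ha' hb'
      refine hconst (Set.Ioo 0 r ×ˢ Set.Ioo (-r) r) ((convex_Ioo _ _).prod (convex_Ioo _ _))
        (fun q hq => ⟨hI ⟨by linarith [hq.1.1], hq.1.2⟩, hI hq.2, ?_, ?_⟩) _ _ _ _ ⟨ha, hb⟩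
        ⟨ha', hb'⟩
      · exact fun h => hq.1.1.not_ge h.2
      · exact fun h => hq.1.1.ne' h.1
    have hup : ∀ a b a' b' : ℝ, a ∈ Set.Ioo (-r) 0 → b ∈ Set.Ioo 0 r → a' ∈ Set.Ioo (-r) 0 →
        b' ∈ Set.Ioo 0 r →
        W (x + a • dir e + b • dir f) = W (x + a' • dir e + b' • dir f) := by
      intro a b a' b' ha hb ha' hb'
      refine hconst (Set.Ioo (-r) 0 ×ˢ Set.Ioo 0 r) ((convex_Ioo _ _).prod (convex_Ioo _ _))
        (fun q hq => ⟨hI ⟨hq.1.1, hq.1.2.trans hr⟩, hI ⟨by linarith [hq.2.1], hq.2.2⟩, ?_, ?_⟩)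
        _ _ _ _ ⟨ha, hb⟩ ⟨ha', hb'⟩
      · exact fun h => hq.2.1.ne' h.1
      · exact fun h => hq.1.2.ne h.1
    have hm : 0 < min r 1 := lt_min hr one_pos
    have hpr : r / 2 ∈ Set.Ioo 0 r := ⟨by linarith, by linarith⟩
    have hnr : -(r / 2) ∈ Set.Ioo (-r) 0 := ⟨by linarith, by linarith⟩
    have hw : r / 2 ∈ Set.Ioo (-r) r := ⟨by linarith, by linarith⟩
    have hwn : -(r / 2) ∈ Set.Ioo (-r) r := ⟨by linarith, by linarith⟩
    refine ⟨W (x + (-(r / 2)) • dir e + (r / 2) • dir f) +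
      W (x + (r / 2) • dir e + (-(r / 2)) • dir f), ?_, ?_⟩
    · filter_upwards [Ioo_mem_nhdsLT (by linarith : 1 - min r 1 < 1)] with τ hτ
      have h1 : 0 < τ := by linarith [hτ.1, min_le_right r 1]
      have h2 : 1 - r < τ := by linarith [hτ.1, min_le_left r 1]
      have h3 : τ - 1 ∈ Set.Ioo (-r) 0 := ⟨by linarith, by linarith [hτ.2]⟩
      have hpt : pt e τ = x + (τ - 1) • dir e := by
        rw [hx, ← pt_one, ← pt_add]; congr 1; ring
      obtain ⟨b, hb, hbr⟩ := ((sideSum_of_transverse hW (τ := τ) (pt_mem_seg e ⟨h1.le, hτ.2.le⟩)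
        (fun g hg => by
          rw [hpt] at hg
          rcases hon (τ - 1) 0 (hI ⟨h3.1, h3.2.trans hr⟩) (by simpa) g (by simpa using hg) with h | h
          · exact h.1
          · exact absurd h.2.1 h3.2.ne) hcr).and (Ioo_mem_nhdsGT hr)).exists
      have := hb.self_of_nhds
      rw [hpt, sub_eq_add_neg _ (b • dir f), ← neg_smul] at this
      rwa [hup _ _ (-(r / 2)) (r / 2) h3 hbr hnr hpr,
        hlow _ _ (r / 2) (-(r / 2)) ⟨h3.1, h3.2.trans hr⟩ ⟨by linarith [hbr.2], by linarith [hbr.1]⟩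
        hw hnr] at this
    · filter_upwards [Ioo_mem_nhdsGT hm] with τ hτ
      have h1 : τ < 1 := by linarith [hτ.2, min_le_right r 1]
      have h3 : τ ∈ Set.Ioo 0 r := ⟨hτ.1, by linarith [hτ.2, min_le_left r 1]⟩
      have hpt : pt f τ = x + τ • dir f := rfl
      obtain ⟨b, hb, hbr⟩ := ((sideSum_of_transverse hW (τ := τ) (pt_mem_seg f ⟨h3.1.le, h1.le⟩)
        (fun g hg => by
          rw [hpt] at hg
          rcases hon 0 τ (by simpa) (hI ⟨by linarith [h3.1], h3.2⟩) g (by simpa using hg) with h | h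
          · exact absurd h.2.1 h3.1.ne'
          · exact h.1) (d := dir e) (by rwa [crossProd_comm, neg_ne_zero])).and
        (Ioo_mem_nhdsGT hr)).exists
      have := hb.self_of_nhds
      rw [hpt, sub_eq_add_neg, ← neg_smul, add_right_comm, add_right_comm x (τ • dir f)] at this
      rwa [hup (-b) τ (-(r / 2)) (r / 2) ⟨by linarith [hbr.2], by linarith [hbr.1]⟩ h3 hnr hpr,
        hright b τ (r / 2) (-(r / 2)) hbr ⟨by linarith [h3.1], h3.2⟩ hpr hwn, add_comm (W _)] at this

end LinkProjection

/-! ### Components that meet: an invariant weight -/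

namespace LinkProjection

variable {n : ℕ} {P : LinkProjection n}

theorem exists_isCrossing_of_mem (c : P.crossings) {e : P.Edge} (he : pos c ∈ seg e) :
    ∃ g u v r, IsCrossing (pos c) e g u v r ∧ ∀ W : ℂ → ZMod 2,
      W (corner (pos c) e g r true true) + W (corner (pos c) e g r true false) +
      (W (corner (pos c) e g r false true) + W (corner (pos c) e g r false false)) =
      ∑ p, W (cornerPt c p) := by
  rcases (strands c).mem_seg_iff.1 he with rfl | rfl
  · exact ⟨_, _, _, _, (strands c).isCrossing, fun W => (sum_bool_prod fun p => W (cornerPt c p)).symm⟩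
  · refine ⟨_, _, _, _, (strands c).isCrossing.symm, fun W => ?_⟩
    rw [sum_bool_prod]
    simp only [fun α β => corner_symm (pos c) (strands c).e (strands c).f (strands c).r α β, cornerPt]
    ring

/-- The change along an edge of the sum of the values on both sides. -/
theorem sideSum_change {W : ℂ → ZMod 2} (hW : ConstOff W P.polygons) (e : P.Edge) {v₀ v₁ : ZMod 2}
    (h0 : ∀ᶠ τ in 𝓝[>] (0 : ℝ), SideSum W e τ v₀) (h1 : ∀ᶠ τ in 𝓝[<] (1 : ℝ), SideSum W e τ v₁) :
    v₁ = v₀ + ∑ c : P.crossings, ind (pos c ∈ seg e) * ∑ p, W (cornerPt c p) := by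
  classical
  have hpar : ∀ c : P.crossings, pos c ∈ seg e → ∃ t ∈ Set.Ioo (0 : ℝ) 1, pt e t = pos c :=
    fun c hc => (notVertex_pos c).exists_pt hc
  choose! t ht hpt using hpar
  have key := total_change_eq_sum_jumps (J := SideSum W e) (fun τ v w => SideSum.unique)
    (Finset.univ.filter fun c : P.crossings => pos c ∈ seg e) t (fun c => ∑ p, W (cornerPt c p))
    (fun τ hτ => ?_) (fun c hc => ht c (Finset.mem_filter.1 hc).2) h0 h1
  · rw [key, Finset.sum_filter]
    congr 1
    refine Finset.sum_congr rfl fun c _ => ?_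
    split_ifs with h
    · rw [ind_true h, one_mul]
    · rw [ind_false h, zero_mul]
  · have hτ' := Set.Ioo_subset_Icc_self hτ
    by_cases hgen : ∀ g, pt e τ ∈ seg g → g = e
    · obtain ⟨b, hb⟩ := (sideSum_of_transverse hW (pt_mem_seg e hτ') hgen (d := Complex.I * dir e)
        (crossProd_I_mul_self_pos (dir_ne_zero e)).ne').exists
      refine ⟨_, _, hb.filter_mono nhdsWithin_le_nhds, hb.filter_mono nhdsWithin_le_nhds, ?_⟩
      rw [Finset.sum_eq_zero, add_zero]
      intro c hc
      refine if_neg fun htc => ?_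
      have hce := (Finset.mem_filter.1 hc).2
      have hpc : pt e τ = pos c := by rw [← htc]; exact hpt c hce
      have h2 := hgen (strands c).e (by rw [hpc]; exact (strands c).isCrossing.mem_left_seg)
      have h3 := hgen (strands c).f (by rw [hpc]; exact (strands c).isCrossing.symm.mem_left_seg)
      exact (strands c).isCrossing.ne (h2.trans h3.symm)
    -- An interior point of `e` is no vertex, so a second edge through it makes it a crossing point.
    · push Not at hgen
      obtain ⟨g, hg, hge⟩ := hgen
      let c : P.crossings := ⟨P.ambient (pt e τ),
        fun i k h => notVertex_pt e hτ ⟨i, k⟩ (P.ambient.injective h),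
        e, g, hge.symm, ambient_mem_arc.2 (pt_mem_seg e hτ'), ambient_mem_arc.2 hg⟩
      have hc : pos c = pt e τ := by simp [pos, c]
      have hce : pos c ∈ seg e := hc ▸ pt_mem_seg e hτ'
      obtain ⟨g, u, v, r, hcr, hsum⟩ := exists_isCrossing_of_mem c hce
      obtain rfl : u = τ := pt_injective e (hcr.pt_left.trans hc)
      -- Before the crossing the two sides are the backward corners, after it the forward corners;
      -- modulo 2 the change is the sum over all four.
      refine ⟨W (corner (pos c) e g r false true) + W (corner (pos c) e g r false false),
        W (corner (pos c) e g r true true) + W (corner (pos c) e g r true false), ?_, ?_, ?_⟩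
      · filter_upwards [Ioo_mem_nhdsLT (by linarith [hcr.r_pos] : u - r < u)] with τ' h
        have := hcr.sideSum hW false (a := u - τ') ⟨by linarith [h.2], by linarith [h.1]⟩
        simpa using this
      · filter_upwards [Ioo_mem_nhdsGT (by linarith [hcr.r_pos] : u < u + r)] with τ' h
        have := hcr.sideSum hW true (a := τ' - u) ⟨by linarith [h.1], by linarith [h.2]⟩
        simpa using this
      · rw [Finset.sum_eq_single c]
        · rw [if_pos (pt_injective e ((hpt c hce).trans hc)), ← hsum]
          generalize W _ = a₁
          generalize W _ = a₂
          generalize W _ = a₃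
          generalize W _ = a₄
          revert a₁ a₂ a₃ a₄; decide
        · intro d hd hdc
          refine if_neg fun htd => hdc (pos_injective ?_)
          rw [hc, ← htd]
          exact (hpt d (Finset.mem_filter.1 hd).2).symm
        · intro h
          exact absurd (Finset.mem_filter.2 ⟨Finset.mem_univ c, hce⟩ : c ∈ _) h

/-- The number, modulo 2, of strands of component `i` at a crossing point. -/
noncomputable def strandParity (i : Fin n) (c : P.crossings) : ZMod 2 :=
  ind ((strands c).e.1 = i) + ind ((strands c).f.1 = i)

theorem sum_ind_eq (i : Fin n) (e : P.Edge) :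
    ∑ k : ZMod (P.size i), ind ((⟨i, k⟩ : P.Edge) = e) = ind (e.1 = i) := by
  classical
  obtain ⟨j, l⟩ := e
  by_cases h : j = i
  · subst h
    rw [Finset.sum_eq_single l]
    · rw [ind_true rfl, ind_true rfl]
    · intro k _ hk
      exact ind_false fun h => hk (by simpa using h)
    · intro h; exact absurd (Finset.mem_univ _) h
  · rw [ind_false h]
    exact Finset.sum_eq_zero fun k _ => ind_false fun h' => h (congrArg Sigma.fst h').symm

theorem sum_ind_mem_seg (i : Fin n) (c : P.crossings) :
    ∑ k : ZMod (P.size i), ind (pos c ∈ seg (⟨i, k⟩ : P.Edge)) = strandParity i c := by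
  rw [strandParity, ← sum_ind_eq, ← sum_ind_eq, ← Finset.sum_add_distrib]
  refine Finset.sum_congr rfl fun k _ => ?_
  rw [(strands c).mem_seg_iff]
  have hne := (strands c).isCrossing.ne
  by_cases h1 : (⟨i, k⟩ : P.Edge) = (strands c).e
  · rw [ind_true (Or.inl h1), ind_true h1, ind_false fun h2 => hne (h1.symm.trans h2), add_zero]
  · rw [ind_false h1, zero_add]
    simp only [h1, false_or]

/-- Going once around a component, the changes of the sum of the values on both sides cancel. -/
theorem sum_strandParity_mul {W : ℂ → ZMod 2} (hW : ConstOff W P.polygons) (i : Fin n) :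
    ∑ c : P.crossings, strandParity i c * ∑ p, W (cornerPt c p) = 0 := by
  choose V hV1 hV0 using exists_sideSum_at_vertex hW
  have h1 : ∀ e : P.Edge, V (nxt e) = V e +
      ∑ c : P.crossings, ind (pos c ∈ seg (nxt e)) * ∑ p, W (cornerPt c p) :=
    fun e => sideSum_change hW (nxt e) (hV0 e) (hV1 (nxt e))
  -- Shifting the cyclic index leaves the total of the vertex values unchanged, so the changes along
  -- the edges add up to 0.
  have h2 : ∑ k : ZMod (P.size i), V ⟨i, k + 1⟩ = ∑ k : ZMod (P.size i), V ⟨i, k⟩ :=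
    Equiv.sum_comp (Equiv.addRight (1 : ZMod (P.size i))) fun k => V ⟨i, k⟩
  have h3 : ∑ k : ZMod (P.size i), V ⟨i, k + 1⟩ = ∑ k : ZMod (P.size i), (V ⟨i, k⟩ +
      ∑ c : P.crossings, ind (pos c ∈ seg (⟨i, k + 1⟩ : P.Edge)) * ∑ p, W (cornerPt c p)) :=
    Finset.sum_congr rfl fun k _ => h1 ⟨i, k⟩
  rw [h2, Finset.sum_add_distrib, left_eq_add] at h3
  have h4 : ∑ k : ZMod (P.size i), ∑ c : P.crossings,
        ind (pos c ∈ seg (⟨i, k + 1⟩ : P.Edge)) * ∑ p, W (cornerPt c p) =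
      ∑ k : ZMod (P.size i), ∑ c : P.crossings,
        ind (pos c ∈ seg (⟨i, k⟩ : P.Edge)) * ∑ p, W (cornerPt c p) :=
    Equiv.sum_comp (Equiv.addRight (1 : ZMod (P.size i))) fun k =>
      ∑ c : P.crossings, ind (pos c ∈ seg (⟨i, k⟩ : P.Edge)) * ∑ p, W (cornerPt c p)
  rw [← h3, h4, Finset.sum_comm]
  refine Finset.sum_congr rfl fun c _ => ?_
  rw [← Finset.sum_mul, sum_ind_mem_seg]

/-- Every region is incident to an even number of crossing points of a component with the other
components. -/
theorem sum_strandParity_mul_incident (i : Fin n) {R : Set ℂ} (hR : P.IsRegion R) :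
    ∑ c : P.crossings, strandParity i c * ind (c ∈ P.incident R) = 0 := by
  classical
  rw [← sum_strandParity_mul (constOff_reg.comp fun Q => ind (Q = R)) i]
  refine Finset.sum_congr rfl fun c _ => ?_
  by_cases hc : (strands c).e.1 = (strands c).f.1
  -- A self-crossing is either passed twice by component `i` or not at all, so it drops out.
  · rw [strandParity, hc, ZMod.two_add_self, zero_mul, zero_mul]
  · rw [← sum_cornerRegions_of_injective c (injective_reg_cornerPt c hc) fun Q => ind (Q = R)]
    congr 1
    by_cases h : c ∈ P.incident R
    · rw [ind_true h, Finset.sum_eq_single R (fun Q _ hQ => ind_false hQ)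
        fun h' => absurd ((mem_cornerRegions_iff c hR).2 h) h', ind_true rfl]
    · rw [ind_false h, Finset.sum_eq_zero]
      rintro Q hQ
      refine ind_false ?_
      rintro rfl
      exact h ((mem_cornerRegions_iff c hR).1 hQ)

/-! ### Diagrams as an affine space over `ZMod 2` -/

namespace Diagram

theorem overArc_eq (D : P.Diagram) (c : P.crossings) :
    D.overArc c = (strands c).e ∨ D.overArc c = (strands c).f := by
  have := D.overArc_mem c
  rwa [← ambient_pos c, ambient_mem_arc, (strands c).mem_seg_iff] at this

/-- Only two strands compete to be the overcrossing arc, so successive switches add modulo 2. -/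
theorem ind_overArc_ne (D D' D'' : P.Diagram) (c : P.crossings) :
    ind (D''.overArc c ≠ D.overArc c) =
      ind (D'.overArc c ≠ D.overArc c) + ind (D''.overArc c ≠ D'.overArc c) := by
  have hne := (strands c).isCrossing.ne
  rcases D.overArc_eq c with h | h <;> rcases D'.overArc_eq c with h' | h' <;>
    rcases D''.overArc_eq c with h'' | h'' <;> rw [h, h', h''] <;> simp [ind, hne, hne.symm] <;>
    decide

theorem exists_isSwitch (D : P.Diagram) (S : Set P.crossings) : ∃ D', IsSwitch S D D' := by
  classical
  have h : ∀ c : P.crossings, ∃ e : P.Edge, (c : Plane) ∈ P.arc e ∧ (e ≠ D.overArc c ↔ c ∈ S) := by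
    intro c
    have h1 : (c : Plane) ∈ P.arc (strands c).e := by
      rw [← ambient_pos c, ambient_mem_arc]; exact (strands c).isCrossing.mem_left_seg
    have h2 : (c : Plane) ∈ P.arc (strands c).f := by
      rw [← ambient_pos c, ambient_mem_arc]; exact (strands c).isCrossing.symm.mem_left_seg
    by_cases hS : c ∈ S
    · rcases D.overArc_eq c with h | h
      · exact ⟨_, h2, by simp [h, hS, (strands c).isCrossing.ne.symm]⟩
      · exact ⟨_, h1, by simp [h, hS, (strands c).isCrossing.ne]⟩
    · exact ⟨_, D.overArc_mem c, by simp [hS]⟩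
  choose o ho1 ho2 using h
  exact ⟨⟨o, ho1⟩, ho2⟩

theorem isSwitch_iff {S : Set P.crossings} {D D' : P.Diagram} :
    IsSwitch S D D' ↔ ∀ c, ind (D'.overArc c ≠ D.overArc c) = ind (c ∈ S) := by
  refine forall_congr' fun c => ⟨fun h => by rw [h], fun h => ?_⟩
  by_cases h1 : D'.overArc c ≠ D.overArc c <;> by_cases h2 : c ∈ S <;> simp_all [ind]

/-- A functional that vanishes on all regions is invariant under region crossing changes. -/
theorem sum_mul_eq_zero_of_reflTransGen {w : P.crossings → ZMod 2}
    (hw : ∀ R, P.IsRegion R → ∑ c, w c * ind (c ∈ P.incident R) = 0) {D D' : P.Diagram}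
    (h : Relation.ReflTransGen RegionCrossingChange D D') :
    ∑ c, w c * ind (D'.overArc c ≠ D.overArc c) = 0 := by
  induction h with
  | refl => exact Finset.sum_eq_zero fun c _ => by rw [ind_false (by simp), mul_zero]
  | @tail D' D'' _ h2 ih =>
    obtain ⟨R, hR, hsw⟩ := h2
    rw [isSwitch_iff] at hsw
    simp only [ind_overArc_ne D D' D'', hsw, mul_add, Finset.sum_add_distrib, ih, hw R hR, add_zero]

/-- Sums of incidence vectors are realised by concatenating sequences of changes, and the only
scalars are 0 and 1. The quantifier over `D` stays inside, so that the second sequence can start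
where the first ends. -/
theorem exists_reflTransGen_of_mem_span {x : P.crossings → ZMod 2}
    (hx : x ∈ Submodule.span (ZMod 2) {y : P.crossings → ZMod 2 |
      ∃ R, P.IsRegion R ∧ y = fun c => ind (c ∈ P.incident R)}) :
    ∀ D : P.Diagram, ∃ D', (∀ c, ind (D'.overArc c ≠ D.overArc c) = x c) ∧
      Relation.ReflTransGen RegionCrossingChange D D' := by
  have hzero : ∀ D : P.Diagram, ∃ D' : P.Diagram, (∀ c, ind (D'.overArc c ≠ D.overArc c) =
      (0 : P.crossings → ZMod 2) c) ∧ Relation.ReflTransGen RegionCrossingChange D D' :=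
    fun D => ⟨D, fun c => ind_false (by simp), .refl⟩
  induction hx using Submodule.span_induction with
  | mem x hx =>
    obtain ⟨R, hR, rfl⟩ := hx
    intro D
    obtain ⟨D', hD'⟩ := D.exists_isSwitch (P.incident R)
    exact ⟨D', isSwitch_iff.1 hD', .single ⟨R, hR, hD'⟩⟩
  | zero => exact hzero
  | add x y _ _ hx hy =>
    intro D
    obtain ⟨D', h1, h2⟩ := hx D
    obtain ⟨D'', h3, h4⟩ := hy D'
    refine ⟨D'', fun c => ?_, h2.trans h4⟩
    rw [ind_overArc_ne D D' D'', h1, h3, Pi.add_apply]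
  | smul a x _ hx =>
    rcases ZMod.two_eq_zero_or_one a with rfl | rfl
    · rw [zero_smul]; exact hzero
    · rw [one_smul]; exact hx

/-- All crossing points are admissible if only the zero functional vanishes on all regions. -/
theorem admissible_of_forall_eq_zero
    (h : ∀ w : P.crossings → ZMod 2,
      (∀ R, P.IsRegion R → ∑ c, w c * ind (c ∈ P.incident R) = 0) → w = 0)
    (D : P.Diagram) (S : Set P.crossings) : D.Admissible S := by
  classical
  have htop : Submodule.span (ZMod 2) {y : P.crossings → ZMod 2 |
      ∃ R, P.IsRegion R ∧ y = fun c => ind (c ∈ P.incident R)} = ⊤ := by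
    by_contra hne
    -- If the span is proper, a nonzero linear form kills it; the coefficients of this form are a
    -- forbidden weight.
    obtain ⟨f, hf0, hf⟩ := Submodule.exists_le_ker_of_lt_top _ (lt_top_iff_ne_top.2 hne)
    refine hf0 (LinearMap.ext fun x => ?_)
    have h0 : (fun c => f (Pi.single c 1)) = 0 := h _ fun R hR => by
      have h1 : f (fun c => ind (c ∈ P.incident R)) = 0 :=
        hf (Submodule.subset_span ⟨R, hR, rfl⟩)
      rw [LinearMap.pi_apply_eq_sum_univ] at h1
      rw [← h1]
      refine Finset.sum_congr rfl fun c _ => ?_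
      rw [smul_eq_mul, mul_comm]
      congr 2
      funext j; simp [Pi.single_apply, eq_comm]
    rw [LinearMap.pi_apply_eq_sum_univ]
    refine Finset.sum_eq_zero fun c _ => ?_
    have h1 := congrFun h0 c
    have h2 : (fun j => if c = j then (1 : ZMod 2) else 0) = Pi.single c 1 := by
      funext j; simp [Pi.single_apply, eq_comm]
    rw [h2, show f (Pi.single c 1) = 0 from h1, smul_zero]
  obtain ⟨D', h1, h2⟩ := exists_reflTransGen_of_mem_span
    (x := fun c => ind (c ∈ S)) (htop ▸ Submodule.mem_top) D
  exact ⟨D', isSwitch_iff.2 h1, h2⟩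

end Diagram

/-! ### The two equivalences -/

theorem forall_isIsolated_iff : (∀ i, P.IsIsolated i) ↔
    ∀ e f : P.Edge, e.1 ≠ f.1 → Disjoint (seg e) (seg f) := by
  constructor
  · intro h e f hef
    rw [Set.disjoint_left]
    intro x hxe hxf
    exact Set.disjoint_left.1 (h e.1 f.1 hef.symm) (ambient_mem_component.2 ⟨e, rfl, hxe⟩)
      (ambient_mem_component.2 ⟨f, rfl, hxf⟩)
  · intro h i j hij
    rw [Set.disjoint_left]
    intro z hzi hzj
    rw [← P.ambient.apply_symm_apply z, ambient_mem_component] at hzi hzj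
    obtain ⟨e, rfl, he⟩ := hzi
    obtain ⟨f, rfl, hf⟩ := hzj
    exact Set.disjoint_left.1 (h e f hij.symm) he hf

/-- If two components meet, then they have a crossing point. -/
theorem exists_strands_ne {e f : P.Edge} (hef : e.1 ≠ f.1) (h : ¬ Disjoint (seg e) (seg f)) :
    ∃ c : P.crossings, (strands c).e.1 ≠ (strands c).f.1 := by
  obtain ⟨x, hxe, hxf⟩ := Set.not_disjoint_iff.1 h
  -- A vertex lies only on edges of its own component, so the meeting point is no vertex.
  have hfst : ∀ {g e : P.Edge}, src g ∈ seg e → g.1 = e.1 := fun h => by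
    rcases eq_or_eq_nxt_of_src_mem h with rfl | rfl <;> rfl
  have hne : e ≠ f := fun h => hef (congrArg _ h)
  let c : P.crossings := ⟨P.ambient x, fun i k hik => by
    obtain rfl : x = src (⟨i, k⟩ : P.Edge) := P.ambient.injective hik
    exact hef ((hfst hxe).symm.trans (hfst hxf)),
    e, f, hne, ambient_mem_arc.2 hxe, ambient_mem_arc.2 hxf⟩
  have hc : pos c = x := by simp [pos, c]
  have h1 := (strands c).mem_seg_iff.1 (hc.symm ▸ hxe : pos c ∈ seg e)
  have h2 := (strands c).mem_seg_iff.1 (hc.symm ▸ hxf : pos c ∈ seg f)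
  refine ⟨c, ?_⟩
  rcases h1 with h1 | h1 <;> rcases h2 with h2 | h2 <;> rw [h1, h2] at hef
  · exact absurd rfl hef
  · exact hef
  · exact hef.symm
  · exact absurd rfl hef

/-- If two components cross at `c`, the weight `strandParity` of one of them is invariant under
region crossing changes, yet it gives 1 for the switch of `c` alone. -/
theorem forall_admissible_iff (D : P.Diagram) :
    (∀ c : P.crossings, D.Admissible {c}) ↔ ∀ i, P.IsIsolated i := by
  rw [forall_isIsolated_iff]
  constructor
  · intro h e f hef
    by_contra hdis
    obtain ⟨c, hc⟩ := exists_strands_ne hef hdis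
    obtain ⟨D', hsw, hD'⟩ := h c
    rw [Diagram.isSwitch_iff] at hsw
    have h1 := Diagram.sum_mul_eq_zero_of_reflTransGen
      (fun R hR => sum_strandParity_mul_incident (strands c).e.1 hR) hD'
    simp only [hsw] at h1
    rw [Finset.sum_eq_single c] at h1
    · rw [strandParity, ind_true rfl, ind_false hc.symm, ind_true (Set.mem_singleton c)] at h1
      exact absurd h1 (by decide)
    · intro d _ hd
      rw [ind_false (by simpa using hd), mul_zero]
    · intro h; exact absurd (Finset.mem_univ _) h
  · intro h c
    exact Diagram.admissible_of_forall_eq_zero (fun w hw => eq_zero_of_sum_incident_eq_zero h hw) D _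

theorem isPreconnected_component (i : Fin n) : IsPreconnected (P.component i) := by
  have : P.component i = P.ambient '' (P.curve i '' Set.Icc 0 (P.size i)) := by
    ext z
    rw [← P.ambient.apply_symm_apply z, ambient_mem_component, P.ambient.injective.mem_set_image]
    constructor
    · rintro ⟨e, rfl, he⟩
      obtain ⟨t, ht, hte⟩ := mem_seg_iff.1 he
      have h1 : (idx e : ℝ) + 1 ≤ P.size e.1 := by exact_mod_cast idx_lt e
      refine ⟨idx e + t, ⟨add_nonneg (Nat.cast_nonneg _) ht.1, by linarith [ht.2]⟩, ?_⟩
      rw [curve_add _ (idx_lt e) ht, edge_idx, hte]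
    · rintro ⟨U, hU, hUz⟩
      rw [← hUz]
      exact curve_mem_seg_of_Icc hU
  rw [this]
  exact (isPreconnected_Icc.image _ (continuous_curve i).continuousOn).image _
    P.ambient.continuous.continuousOn

theorem isClosed_component (i : Fin n) : IsClosed (P.component i) :=
  isClosed_iUnion_of_finite fun k => P.ambient.isClosedMap _ (isClosed_seg ⟨i, k⟩)

/-- Each `K_i` is connected, so `κ` maps the indices onto the connected components of the
projection. It is injective exactly when the `K_i` are disjoint, and for a surjection from `Fin n`
injectivity is a matter of counting. -/
theorem forall_isIsolated_iff_card :
    (∀ i, P.IsIsolated i) ↔ Nat.card (ConnectedComponents P.carrier) = n := by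
  have hne : ∀ i, ∃ z : P.carrier, (z : ℂ) ∈ P.component i := by
    intro i
    have : P.ambient (src (P.edge i 0)) ∈ P.component i :=
      ambient_mem_component.2 ⟨P.edge i 0, rfl, src_mem_seg _⟩
    exact ⟨⟨_, Set.mem_iUnion.2 ⟨i, this⟩⟩, this⟩
  choose z hz using hne
  let κ : Fin n → ConnectedComponents P.carrier := fun i => (z i : ConnectedComponents P.carrier)
  have hκ : ∀ (y : P.carrier) i, (y : ℂ) ∈ P.component i →
      (y : ConnectedComponents P.carrier) = κ i := by
    intro y i hy
    rw [ConnectedComponents.coe_eq_coe']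
    have hsub : P.component i ⊆ P.carrier := Set.subset_iUnion P.component i
    have hpre : IsPreconnected ((↑) ⁻¹' P.component i : Set P.carrier) := by
      rw [← Topology.IsInducing.subtypeVal.isPreconnected_image, Subtype.image_preimage_coe,
        Set.inter_eq_right.2 hsub]
      exact isPreconnected_component i
    exact hpre.subset_connectedComponent (hz i) hy
  have hsurj : Function.Surjective κ := by
    intro q
    obtain ⟨y, rfl⟩ := ConnectedComponents.surjective_coe q
    obtain ⟨i, hi⟩ := Set.mem_iUnion.1 y.2
    exact ⟨i, (hκ y i hi).symm⟩
  constructor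
  · intro h
    have hinj : Function.Injective κ := by
      intro i j hij
      by_contra hne
      -- The complement of `K_i` in the projection is the union of the other components, finitely
      -- many closed sets.
      have hclopen : IsClopen ((↑) ⁻¹' P.component i : Set P.carrier) := by
        refine ⟨(isClosed_component i).preimage continuous_subtype_val, ?_⟩
        have : ((↑) ⁻¹' P.component i : Set P.carrier) =
            ((↑) ⁻¹' (⋃ j : {j // j ≠ i}, P.component j) : Set P.carrier)ᶜ := by
          ext y
          simp only [Set.mem_preimage, Set.mem_compl_iff, Set.mem_iUnion, not_exists]
          constructor
          · exact fun hy j hj => Set.disjoint_left.1 (h i j j.2) hy hj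
          · intro hy
            obtain ⟨j, hj⟩ := Set.mem_iUnion.1 y.2
            by_cases hji : j = i
            · exact hji ▸ hj
            · exact absurd hj (hy ⟨j, hji⟩)
        rw [this, isOpen_compl_iff]
        exact (isClosed_iUnion_of_finite fun j : {j // j ≠ i} =>
          isClosed_component (j : Fin n)).preimage continuous_subtype_val
      have h1 : z j ∈ connectedComponent (z i) := ConnectedComponents.coe_eq_coe'.1 hij.symm
      exact Set.disjoint_left.1 (h i j (Ne.symm hne))
        (hclopen.connectedComponent_subset (hz i) h1) (hz j)
    rw [← Nat.card_eq_of_bijective κ ⟨hinj, hsurj⟩, Nat.card_fin]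
  · intro hcard i j hji
    have hinj : Function.Injective κ :=
      (hsurj.bijective_of_nat_card_le (by rw [hcard, Nat.card_fin])).1
    rw [Set.disjoint_left]
    intro y hyi hyj
    let y' : P.carrier := ⟨y, Set.mem_iUnion.2 ⟨i, hyi⟩⟩
    exact hji (hinj ((hκ y' j hyj).symm.trans (hκ y' i hyi)))

end LinkProjection

theorem corollary1 (n : ℕ) (P : LinkProjection n) (D : P.Diagram) :
    ((∀ c : P.crossings, D.Admissible {c}) ↔ ∀ i : Fin n, P.IsIsolated i) ∧
    ((∀ i : Fin n, P.IsIsolated i) ↔ Nat.card (ConnectedComponents P.carrier) = n) :=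
  ⟨LinkProjection.forall_admissible_iff D, LinkProjection.forall_isIsolated_iff_card⟩
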